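/- Let $\rho$ be a two-qubit state, i.e. a positive semidefinite matrix of trace one on $\mathbb C^2\otimes\mathbb C^2$, and let $\rho^\Gamma$ be its partial transpose with respect to the second qubit. Let $N$ be the negativity of $\rho$, twice the sum of the absolute values of the negative eigenvalues of $\rho^\Gamma$ (counted with multiplicity), and let $C=\max(0,\lambda_1-\lambda_2-\lambda_3-\lambda_4)$ be its concurrence, where $\lambda_1\ge\lambda_2\ge\lambda_3\ge\lambda_4$ are the square roots of the eigenvalues of $\sqrt\rho\,(\sigma_y\otimes\sigma_y)\rho^*(\sigma_y\otimes\sigma_y)\sqrt\rho$. The Bell states are $(|00\rangle\pm|11\rangle)/\sqrt2$ and $(|01\rangle\pm|10\rangle)/\sqrt2$; "up to local unitaries" means up to the action of $U\otimes V$ with $U,V$ unitary $2\times2$ matrices. 1. $N\le C$. If $C>0$ (that is, if $\rho$ is entangled), then $\rho^\Gamma$ has exactly one negative eigenvalue $\mu$, its eigenvector is unique up to a scalar, $N=2|\mu|$, and $N=C$ if and only if the normalized eigenvector of $\rho^\Gamma$ for $\mu$ is a Bell state up to local unitaries. Every pure state and every Bell-diagonal state satisfies $N=C$. 2. $N\ge\sqrt{(1-C)^2+C^2}-(1-C)$,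 and $N^2+2N(1-C)-C^2\ge0$. If $C>0$, then equality holds in the first inequality if and only if, up to local unitaries, $\rho$ is the quasi-distillable state $$C\,|\Phi^+\rangle\langle\Phi^+|+(1-C)\,|01\rangle\langle01|,\qquad |\Phi^+\rangle=\tfrac1{\sqrt2}(|00\rangle+|11\rangle),$$ which has rank $2$ when $C<1$ (and is a Bell state when $C=1$). Moreover, if $\rho$ equals $c\,|\Phi^+\rangle\langle\Phi^+|+(1-c)\,|01\rangle\langle01|$ up to local unitaries for some $c\in[0,1]$, then $C=c$. -/

import Mathlib

open scoped Matrix Kronecker ComplexOrder MatrixOrder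

noncomputable section

namespace TwoQubit

/-- Index set of the computational basis: `(i, j)` stands for `|ij⟩`. -/
abbrev Idx : Type := Fin 2 × Fin 2

/-- A (possibly mixed) two-qubit state: a positive semidefinite matrix of trace one. -/
structure State where
  mat : Matrix Idx Idx ℂ
  posSemidef : mat.PosSemidef
  trace_eq_one : mat.trace = 1

/-- Partial transposition with respect to the second qubit. -/
def partialTranspose (A : Matrix Idx Idx ℂ) : Matrix Idx Idx ℂ :=
  Matrix.of fun a b => A (a.1, b.2) (b.1, a.2)

theorem partialTranspose_isHermitian {A : Matrix Idx Idx ℂ} (hA : A.IsHermitian) :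
    (partialTranspose A).IsHermitian := by
  ext a b
  simpa [partialTranspose] using hA.apply (a.1, b.2) (b.1, a.2)

theorem State.isHermitian_partialTranspose (ρ : State) : (partialTranspose ρ.mat).IsHermitian :=
  partialTranspose_isHermitian ρ.posSemidef.isHermitian

/-- Negativity: twice the sum, with multiplicity, of the absolute values of the negative
eigenvalues of the partial transpose. -/
def negativity (ρ : State) : ℝ :=
  2 * ∑ i, max 0 (-(ρ.isHermitian_partialTranspose.eigenvalues i))

/-- The Pauli matrix `σ_y`. -/
def pauliY : Matrix (Fin 2) (Fin 2) ℂ := !![0, -Complex.I; Complex.I, 0]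

/-- The spin-flipped matrix `(σ_y ⊗ σ_y) ρ* (σ_y ⊗ σ_y)`, with the entrywise complex conjugate. -/
def spinFlip (A : Matrix Idx Idx ℂ) : Matrix Idx Idx ℂ :=
  (pauliY ⊗ₖ pauliY) * A.map star * (pauliY ⊗ₖ pauliY)

/-- `√ρ ρ̃ √ρ`, where `ρ̃` is the spin-flipped state. -/
def woottersMatrix (ρ : State) : Matrix Idx Idx ℂ :=
  CFC.sqrt ρ.mat * spinFlip ρ.mat * CFC.sqrt ρ.mat

theorem pauliY_conjTranspose : pauliYᴴ = pauliY := by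
  ext i j
  fin_cases i <;> fin_cases j <;> simp [pauliY]

theorem spinFlip_isHermitian {A : Matrix Idx Idx ℂ} (hA : A.IsHermitian) :
    (spinFlip A).IsHermitian := by
  have h1 : (A.map star)ᴴ = A.map star := by
    ext a b
    simpa using congrArg star (hA.apply a b)
  unfold Matrix.IsHermitian spinFlip
  rw [Matrix.conjTranspose_mul, Matrix.conjTranspose_mul, Matrix.conjTranspose_kronecker,
    pauliY_conjTranspose, h1, Matrix.mul_assoc]

theorem woottersMatrix_isHermitian (ρ : State) : (woottersMatrix ρ).IsHermitian := by
  have h : (CFC.sqrt ρ.mat)ᴴ = CFC.sqrt ρ.mat :=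
    (IsSelfAdjoint.of_nonneg (CFC.sqrt_nonneg ρ.mat)).star_eq
  unfold Matrix.IsHermitian woottersMatrix
  rw [Matrix.conjTranspose_mul, Matrix.conjTranspose_mul, h,
    (spinFlip_isHermitian ρ.posSemidef.isHermitian).eq, Matrix.mul_assoc]

/-- The square roots of the eigenvalues of `√ρ ρ̃ √ρ`, in decreasing order. -/
def woottersValue (ρ : State) (k : Fin 4) : ℝ :=
  √((woottersMatrix_isHermitian ρ).eigenvalues₀ (Fin.cast (by simp) k))

/-- The (Wootters) concurrence `max(0, λ₁ - λ₂ - λ₃ - λ₄)`. -/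
def concurrence (ρ : State) : ℝ :=
  max 0 (woottersValue ρ 0 - woottersValue ρ 1 - woottersValue ρ 2 - woottersValue ρ 3)

/-- The computational basis vector `|ij⟩`. -/
def ket (i j : Fin 2) : Idx → ℂ := Pi.single (i, j) 1

/-- The rank-one matrix `|v⟩⟨v|`. -/
def proj (v : Idx → ℂ) : Matrix Idx Idx ℂ := Matrix.vecMulVec v (star v)

/-- The four Bell states `(|00⟩ ± |11⟩)/√2`, `(|01⟩ ± |10⟩)/√2`. -/
def bell : Fin 4 → Idx → ℂ :=
  ![((√2 : ℝ) : ℂ)⁻¹ • (ket 0 0 + ket 1 1),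
    ((√2 : ℝ) : ℂ)⁻¹ • (ket 0 0 - ket 1 1),
    ((√2 : ℝ) : ℂ)⁻¹ • (ket 0 1 + ket 1 0),
    ((√2 : ℝ) : ℂ)⁻¹ • (ket 0 1 - ket 1 0)]

/-- `v` is a Bell state up to local unitary transformations. -/
def IsBellUpToLocalUnitary (v : Idx → ℂ) : Prop :=
  ∃ U ∈ Matrix.unitaryGroup (Fin 2) ℂ, ∃ V ∈ Matrix.unitaryGroup (Fin 2) ℂ, ∃ k : Fin 4,
    v = (U ⊗ₖ V) *ᵥ bell k

/-- `A` and `B` agree up to a local unitary transformation. -/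
def LocalUnitaryEquiv (A B : Matrix Idx Idx ℂ) : Prop :=
  ∃ U ∈ Matrix.unitaryGroup (Fin 2) ℂ, ∃ V ∈ Matrix.unitaryGroup (Fin 2) ℂ,
    A = (U ⊗ₖ V) * B * (U ⊗ₖ V)ᴴ

/-- The quasi-distillable matrix `c |Φ⁺⟩⟨Φ⁺| + (1 - c) |01⟩⟨01|`, `Φ⁺ = (|00⟩ + |11⟩)/√2`. -/
def quasiDistillable (c : ℝ) : Matrix Idx Idx ℂ :=
  (c : ℂ) • proj (bell 0) + ((1 - c : ℝ) : ℂ) • proj (ket 0 1)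

/-- `ρ` is a pure state. -/
def State.IsPure (ρ : State) : Prop := ∃ ψ : Idx → ℂ, ρ.mat = proj ψ

/-- `ρ` is diagonal in the Bell basis. -/
def State.IsBellDiagonal (ρ : State) : Prop :=
  ∃ p : Fin 4 → ℝ, ρ.mat = ∑ k, (p k : ℂ) • proj (bell k)

end TwoQubit

end

/-!
Write `⟨v|ρ^Γ|v⟩` for the quadratic form of the partial transpose and `det v` for the determinant of
`v`, read as a 2×2 matrix. Both quantities are optimal constants for this form: the concurrence is
the least `c ≥ 0` with `-⟨v|ρ^Γ|v⟩ ≤ c |det v|` for all `v`, and the negativity the least `c ≥ 0`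
with `-⟨v|ρ^Γ|v⟩ ≤ (c / 2) ‖v‖²`, provided that `ρ^Γ` has at most one negative eigenvalue. It does:
a negative eigenspace of dimension two would contain a product vector, and there the form is
nonnegative. As `|det v| ≤ ‖v‖² / 2`, with equality for unit vectors exactly at the Bell states up
to local unitaries, the upper bound and its equality case follow.

To see that the concurrence is this optimal constant, use a Takagi factorization to write
`ρ = X Xᴴ` with columns orthogonal for the spin-flip form (Wootters). If `ρ` is invertible, local
filtering makes it Bell-diagonal, where the form is explicit. The general case follows by a limit.

If the optimal `v` is brought to Schmidt form by local unitaries, the concurrence becomes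
`2 (|ρ₀₀,₁₁| - √(ρ₀₁,₀₁ ρ₁₀,₁₀))`. In these coordinates the partial transpose has the off-diagonal
entry `ρ₀₀,₁₁` in its block on the span of `|01⟩` and `|10⟩`. The negative eigenvalue of this block,
combined with `tr ρ = 1`, gives the lower bound, and equality forces all remaining entries to be
those of a quasi-distillable state.
-/

namespace TwoQubit

open Matrix Filter Topology

section UnitaryMatrices

variable {n : Type*} [Fintype n] [DecidableEq n]

theorem norm_det_of_mem_unitaryGroup {U : Matrix n n ℂ} (hU : U ∈ unitaryGroup n ℂ) :
    ‖U.det‖ = 1 :=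
  CStarRing.norm_of_mem_unitary (det_of_mem_unitary hU)

theorem submatrix_equiv_mem_unitaryGroup {U : Matrix n n ℂ} (hU : U ∈ unitaryGroup n ℂ)
    (σ : Equiv.Perm n) : U.submatrix id σ ∈ unitaryGroup n ℂ := by
  rw [mem_unitaryGroup_iff'] at hU ⊢
  have h : star (U.submatrix id σ) * U.submatrix id σ = (star U * U).submatrix σ σ := rfl
  rw [h, hU, submatrix_one_equiv]

theorem isCompact_unitaryGroup :
    IsCompact {U : Matrix n n ℂ | U ∈ unitaryGroup n ℂ} := by
  have hK : IsCompact
      (Set.univ.pi fun _ : n => Set.univ.pi fun _ : n => Metric.closedBall (0 : ℂ) 1) :=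
    isCompact_univ_pi fun _ => isCompact_univ_pi fun _ => isCompact_closedBall _ _
  refine IsCompact.of_isClosed_subset (X := Matrix n n ℂ) hK ?_ fun U hU i _ j _ => ?_
  · have h : {U : Matrix n n ℂ | U ∈ unitaryGroup n ℂ} = {U | U * Uᴴ = 1} := by
      ext U; exact mem_unitaryGroup_iff
    rw [h]
    exact isClosed_eq (by fun_prop) continuous_const
  · rw [mem_closedBall_zero_iff]
    exact entry_norm_bound_of_unitary hU i j

end UnitaryMatrices

section Takagi

variable {n : Type*} [Fintype n] [DecidableEq n]

open scoped Matrix.Norms.L2Operator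

theorem exists_aeval_eq_cfc {Y : Matrix n n ℂ} (hY : IsStarNormal Y) (f : ℂ → ℂ) :
    ∃ q : Polynomial ℂ, Polynomial.aeval Y q = cfc f Y := by
  classical
  have hfin := Y.finite_spectrum
  refine ⟨Lagrange.interpolate hfin.toFinset id f, ?_⟩
  rw [← cfc_polynomial _ Y]
  exact cfc_congr fun z hz => Lagrange.eval_interpolate_at_node (v := id) f
    Function.injective_id.injOn (hfin.mem_toFinset.2 hz)

theorem exists_symm_unitary_sqrt {Y : Matrix n n ℂ} (hY : Y ∈ unitaryGroup n ℂ) (hs : Yᵀ = Y) :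
    ∃ B ∈ unitaryGroup n ℂ, Bᵀ = B ∧ B * B = Y ∧ ∀ D : Matrix n n ℂ, Commute Y D → Commute B D := by
  have hYn : IsStarNormal Y :=
    ⟨((mem_unitaryGroup_iff'.1 hY).trans (mem_unitaryGroup_iff.1 hY).symm)⟩
  set f : ℂ → ℂ := fun z => Complex.exp (Complex.log z / 2)
  have hcont : ContinuousOn f (spectrum ℂ Y) := Y.finite_spectrum.continuousOn f
  have hnorm : ∀ z ∈ spectrum ℂ Y, ‖z‖ = 1 := fun z hz => by
    simpa using spectrum.subset_circle_of_unitary hY hz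
  have hff : ∀ z ∈ spectrum ℂ Y, f z * f z = z := fun z hz => by
    have hz0 : z ≠ 0 := norm_ne_zero_iff.1 (by simp [hnorm z hz])
    rw [← Complex.exp_add, add_halves, Complex.exp_log hz0]
  have hf1 : ∀ z ∈ spectrum ℂ Y, star (f z) * f z = 1 := fun z hz => by
    have h : ‖f z‖ * ‖f z‖ = 1 := by rw [← norm_mul, hff z hz, hnorm z hz]
    rw [RCLike.star_def, Complex.conj_mul', sq, ← Complex.ofReal_mul, h, Complex.ofReal_one]
  -- a polynomial in `Y` inherits both the symmetry and the commutant of `Y`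
  obtain ⟨q, hq⟩ := exists_aeval_eq_cfc hYn f
  refine ⟨Polynomial.aeval Y q, ?_, ?_, ?_, fun D hD => ?_⟩
  · rw [hq]
    exact (cfc_unitary_iff f Y hYn hcont).2 hf1
  · rw [Polynomial.aeval_eq_sum_range, transpose_sum]
    simp only [transpose_smul, transpose_pow, hs]
  · rw [hq, ← cfc_mul f f Y hcont hcont, cfc_congr (g := id) hff, cfc_id ℂ Y]
  · rw [Polynomial.aeval_eq_sum_range]
    exact Commute.sum_left _ _ _ fun i _ => (hD.pow_left i).smul_left _

theorem exists_svd {A : Matrix n n ℂ} (hA : IsUnit A) :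
    ∃ R ∈ unitaryGroup n ℂ, ∃ S ∈ unitaryGroup n ℂ, ∃ d : n → ℝ, (∀ i, 0 < d i) ∧
      A = R * (diagonal fun i => (d i : ℂ)) * S := by
  have hW : (Aᴴ * A).PosDef := PosDef.conjTranspose_mul_self _ (mulVec_injective_of_isUnit hA)
  set V : Matrix n n ℂ := hW.isHermitian.eigenvectorUnitary.1
  have hVu : V ∈ unitaryGroup n ℂ := hW.isHermitian.eigenvectorUnitary.2
  set e := hW.isHermitian.eigenvalues
  have hVD : Vᴴ * (Aᴴ * A) * V = diagonal fun i => (e i : ℂ) := by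
    have h := hW.isHermitian.conjStarAlgAut_star_eigenvectorUnitary
    rwa [Unitary.conjStarAlgAut_star_apply] at h
  set d : n → ℝ := fun i => √(e i)
  have hd : ∀ i, 0 < d i := fun i => Real.sqrt_pos.2 (hW.eigenvalues_pos i)
  have hd0 : ∀ i, (d i : ℂ) ≠ 0 := fun i => Complex.ofReal_ne_zero.2 (hd i).ne'
  have hdd : ∀ i, (e i : ℂ) = d i * d i := fun i => by
    rw [← Complex.ofReal_mul, Real.mul_self_sqrt (hW.eigenvalues_pos i).le]
  set Δ : Matrix n n ℂ := diagonal fun i => (d i : ℂ)⁻¹ with hΔ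
  have hΔH : Δᴴ = Δ := by
    rw [hΔ, diagonal_conjTranspose]
    exact congrArg diagonal (funext fun i => by simp)
  refine ⟨A * V * Δ, ?_, Vᴴ, Unitary.star_mem hVu, d, hd, ?_⟩
  · rw [mem_unitaryGroup_iff', star_eq_conjTranspose, conjTranspose_mul, conjTranspose_mul, hΔH]
    calc Δ * (Vᴴ * Aᴴ) * (A * V * Δ) = Δ * (Vᴴ * (Aᴴ * A) * V) * Δ := by
          simp only [Matrix.mul_assoc]
      _ = 1 := by
          rw [hVD, hΔ, diagonal_mul_diagonal, diagonal_mul_diagonal, ← diagonal_one]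
          refine congrArg diagonal (funext fun i => ?_)
          rw [hdd]
          field_simp [hd0 i]
  · have h : Δ * (diagonal fun i => (d i : ℂ)) = 1 := by
      rw [hΔ, diagonal_mul_diagonal, ← diagonal_one]
      exact congrArg diagonal (funext fun i => inv_mul_cancel₀ (hd0 i))
    rw [Matrix.mul_assoc (A * V), h, Matrix.mul_one, Matrix.mul_assoc,
      show V * Vᴴ = 1 from mem_unitaryGroup_iff.1 hVu, Matrix.mul_one]

theorem commute_diagonal_of_commute_mul_self {d : n → ℝ} (hd : ∀ i, 0 ≤ d i) {X : Matrix n n ℂ}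
    (h : Commute X ((diagonal fun i => (d i : ℂ)) * diagonal fun i => (d i : ℂ))) :
    Commute X (diagonal fun i => (d i : ℂ)) := by
  ext i j
  have hij := congrFun₂ h.eq i j
  rw [diagonal_mul_diagonal, mul_diagonal, diagonal_mul] at hij
  rw [mul_diagonal, diagonal_mul]
  by_cases hX : X i j = 0
  · simp [hX]
  have hsq : (d j : ℂ) * d j = d i * d i := mul_left_cancel₀ hX (by rw [hij, mul_comm])
  have hdd : d j = d i := by
    rw [← Real.sqrt_mul_self (hd j), ← Real.sqrt_mul_self (hd i)]
    exact congrArg _ (by exact_mod_cast hsq)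
  rw [hdd, mul_comm]

theorem commute_and_transpose_eq_of_diagonal_mul_transpose {d : n → ℝ} (hd : ∀ i, 0 < d i)
    {X : Matrix n n ℂ} (hX : X ∈ unitaryGroup n ℂ)
    (h : (diagonal fun i => (d i : ℂ)) * Xᵀ = X * diagonal fun i => (d i : ℂ)) :
    Commute X (diagonal fun i => (d i : ℂ)) ∧ Xᵀ = X := by
  set Δ : Matrix n n ℂ := diagonal fun i => (d i : ℂ) with hΔ
  have hΔH : Δᴴ = Δ := by
    rw [hΔ, diagonal_conjTranspose]
    exact congrArg diagonal (funext fun i => Complex.conj_ofReal _)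
  have hΔu : IsUnit Δ := isUnit_diagonal.2 <| Pi.isUnit_iff.2 fun i =>
    isUnit_iff_ne_zero.2 (Complex.ofReal_ne_zero.2 (hd i).ne')
  have hH : Xᵀᴴ * Δ = Δ * Xᴴ := by
    simpa only [conjTranspose_mul, hΔH] using congrArg conjTranspose h
  have hΔX : Xᵀ * Δ = Δ * X := by
    calc Xᵀ * Δ = Xᵀ * (Δ * Xᴴ) * X := by
          rw [Matrix.mul_assoc, Matrix.mul_assoc, show Xᴴ * X = 1 from mem_unitaryGroup_iff'.1 hX,
            Matrix.mul_one]
      _ = Xᵀ * Xᵀᴴ * (Δ * X) := by rw [← hH]; simp only [Matrix.mul_assoc]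
      _ = Δ * X := by
          rw [show Xᵀ * Xᵀᴴ = 1 from
            mem_unitaryGroup_iff.1 (transpose_mem_unitaryGroup_iff.2 hX), Matrix.one_mul]
  have hcomm : Commute X Δ := commute_diagonal_of_commute_mul_self (fun i => (hd i).le) <| by
    change X * (Δ * Δ) = Δ * Δ * X
    rw [← Matrix.mul_assoc, ← h, Matrix.mul_assoc, hΔX, Matrix.mul_assoc]
  exact ⟨hcomm, hΔu.mul_left_cancel (h.trans hcomm.eq)⟩

/- With `τ = R Δ S`, the symmetry of `τ` says that the unitary matrix `X = Rᴴ Sᵀ` satisfies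
`Δ Xᵀ = X Δ`, so it is symmetric and commutes with `Δ`; if `B` is its square root, then the complex
conjugate of `R B` brings `τ` to the form `Δ`. -/
theorem exists_takagi {τ : Matrix n n ℂ} (hs : τᵀ = τ) (hu : IsUnit τ) :
    ∃ U ∈ unitaryGroup n ℂ, ∃ d : n → ℝ, (∀ i, 0 < d i) ∧
      Uᵀ * τ * U = diagonal fun i => (d i : ℂ) := by
  obtain ⟨R, hR, S, hS, d, hd, rfl⟩ := exists_svd hu
  set Δ : Matrix n n ℂ := diagonal fun i => (d i : ℂ)
  have hΔT : Δᵀ = Δ := diagonal_transpose _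
  have hR1 : Rᴴ * R = 1 := mem_unitaryGroup_iff'.1 hR
  have hR2 : Rᵀ * Rᵀᴴ = 1 := mem_unitaryGroup_iff.1 (transpose_mem_unitaryGroup_iff.2 hR)
  set X := Rᴴ * Sᵀ with hX
  have hXu : X ∈ unitaryGroup n ℂ :=
    mul_mem (Unitary.star_mem hR) (transpose_mem_unitaryGroup_iff.2 hS)
  have hXT : Xᵀ = S * Rᵀᴴ := by rw [hX, transpose_mul, transpose_transpose]; rfl
  have hΔX : Δ * Xᵀ = X * Δ := by
    calc Δ * Xᵀ = Rᴴ * R * Δ * S * Rᵀᴴ := by rw [hXT, hR1, Matrix.one_mul, ← Matrix.mul_assoc]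
      _ = Rᴴ * (R * Δ * S)ᵀ * Rᵀᴴ := by rw [hs]; simp only [Matrix.mul_assoc]
      _ = X * Δ * (Rᵀ * Rᵀᴴ) := by
        simp only [hX, transpose_mul, hΔT, Matrix.mul_assoc]
      _ = X * Δ := by rw [hR2, Matrix.mul_one]
  obtain ⟨hXc, hXs⟩ := commute_and_transpose_eq_of_diagonal_mul_transpose hd hXu hΔX
  obtain ⟨B, hB, hBs, hBB, hBc⟩ := exists_symm_unitary_sqrt hXu hXs
  have hB1 : Bᴴ * B = 1 := mem_unitaryGroup_iff'.1 hB
  have hB2 : B * Bᵀᴴ = 1 := by rw [hBs]; exact mem_unitaryGroup_iff.1 hB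
  refine ⟨(R * B)ᴴᵀ, transpose_mem_unitaryGroup_iff.2 (Unitary.star_mem (mul_mem hR hB)), d, hd, ?_⟩
  calc (R * B)ᴴᵀᵀ * (R * Δ * S) * (R * B)ᴴᵀ
      = Bᴴ * (Rᴴ * R) * Δ * (S * Rᵀᴴ) * Bᵀᴴ := by
        simp only [transpose_transpose, conjTranspose_mul, transpose_mul, Matrix.mul_assoc]
        rfl
    _ = Bᴴ * Δ * B * (B * Bᵀᴴ) := by
        rw [hR1, ← hXT, hXs, ← hBB]
        simp only [Matrix.mul_assoc, Matrix.one_mul]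
    _ = Bᴴ * B * Δ := by
      rw [hB2, Matrix.mul_one, Matrix.mul_assoc, ← (hBc Δ hXc).eq, ← Matrix.mul_assoc]
    _ = Δ := by rw [hB1, Matrix.one_mul]

theorem exists_takagi_antitone {m : ℕ} {τ : Matrix (Fin m) (Fin m) ℂ} (hs : τᵀ = τ)
    (hu : IsUnit τ) :
    ∃ U ∈ unitaryGroup (Fin m) ℂ, ∃ d : Fin m → ℝ, Antitone d ∧ (∀ i, 0 < d i) ∧
      Uᵀ * τ * U = diagonal fun i => (d i : ℂ) := by
  obtain ⟨U, hU, d, hd, h⟩ := exists_takagi hs hu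
  set σ := Tuple.sort fun i => -d i
  have hσ : Monotone ((fun i => -d i) ∘ σ) := Tuple.monotone_sort _
  refine ⟨U.submatrix id σ, submatrix_equiv_mem_unitaryGroup hU σ, d ∘ σ,
    fun i j hij => neg_le_neg_iff.1 (hσ hij), fun i => hd _, ?_⟩
  have hsub : (U.submatrix id σ)ᵀ * τ * U.submatrix id σ = (Uᵀ * τ * U).submatrix σ σ := rfl
  rw [hsub, h, submatrix_diagonal_equiv]
  rfl

end Takagi

section Vectors

/-- The coefficient matrix of a two-qubit vector, which identifies `ℂ² ⊗ ℂ²` with the `2 × 2`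
matrices. -/
def coeffMatrix (v : Idx → ℂ) : Matrix (Fin 2) (Fin 2) ℂ := of fun i j => v (i, j)

/-- The two-qubit vector with a given coefficient matrix. -/
def ofCoeff (M : Matrix (Fin 2) (Fin 2) ℂ) : Idx → ℂ := fun a => M a.1 a.2

/-- The determinant of the coefficient matrix: twice its modulus is the concurrence of the pure
state `v`, and it vanishes exactly on product vectors. -/
def vecDet (v : Idx → ℂ) : ℂ := v (0, 0) * v (1, 1) - v (0, 1) * v (1, 0)

/-- The squared Euclidean norm; `Idx → ℂ` itself carries the supremum norm. -/
noncomputable def vecNormSq (v : Idx → ℂ) : ℝ := ∑ a, ‖v a‖ ^ 2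

/-- The vector `x |01⟩ + y |10⟩`. -/
def antiVec (x y : ℂ) : Idx → ℂ := ofCoeff !![0, x; y, 0]

/-- The polarization of the determinant of `2 × 2` matrices. -/
def polarDet (X Y : Matrix (Fin 2) (Fin 2) ℂ) : ℂ :=
  X 0 0 * Y 1 1 + X 1 1 * Y 0 0 - X 0 1 * Y 1 0 - X 1 0 * Y 0 1

@[simp]
theorem coeffMatrix_ofCoeff (M : Matrix (Fin 2) (Fin 2) ℂ) : coeffMatrix (ofCoeff M) = M := rfl

@[simp]
theorem ofCoeff_coeffMatrix (v : Idx → ℂ) : ofCoeff (coeffMatrix v) = v := rfl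

theorem det_coeffMatrix (v : Idx → ℂ) : (coeffMatrix v).det = vecDet v := by
  simp [det_fin_two, coeffMatrix, vecDet]

theorem coeffMatrix_kronecker_mulVec (U V : Matrix (Fin 2) (Fin 2) ℂ) (v : Idx → ℂ) :
    coeffMatrix ((U ⊗ₖ V) *ᵥ v) = U * coeffMatrix v * Vᵀ := by
  ext i j
  simp only [coeffMatrix, of_apply, mulVec, dotProduct, kronecker_apply, Fintype.sum_prod_type,
    Matrix.mul_apply, transpose_apply, Fin.sum_univ_two]
  ring

theorem kronecker_mulVec_ofCoeff (U V M : Matrix (Fin 2) (Fin 2) ℂ) :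
    (U ⊗ₖ V) *ᵥ ofCoeff M = ofCoeff (U * M * Vᵀ) := by
  rw [← coeffMatrix_ofCoeff M, ← coeffMatrix_kronecker_mulVec]
  rfl

theorem vecDet_kronecker_mulVec (U V : Matrix (Fin 2) (Fin 2) ℂ) (v : Idx → ℂ) :
    vecDet ((U ⊗ₖ V) *ᵥ v) = U.det * V.det * vecDet v := by
  rw [← det_coeffMatrix, coeffMatrix_kronecker_mulVec, det_mul, det_mul, det_transpose,
    det_coeffMatrix]
  ring

theorem norm_vecDet_kronecker_mulVec {U V : Matrix (Fin 2) (Fin 2) ℂ}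
    (hU : U ∈ unitaryGroup (Fin 2) ℂ) (hV : V ∈ unitaryGroup (Fin 2) ℂ) (v : Idx → ℂ) :
    ‖vecDet ((U ⊗ₖ V) *ᵥ v)‖ = ‖vecDet v‖ := by
  rw [vecDet_kronecker_mulVec, norm_mul, norm_mul, norm_det_of_mem_unitaryGroup hU,
    norm_det_of_mem_unitaryGroup hV, one_mul, one_mul]

theorem vecDet_add (v w : Idx → ℂ) :
    vecDet (v + w) = vecDet v + polarDet (coeffMatrix v) (coeffMatrix w) + vecDet w := by
  simp only [vecDet, polarDet, coeffMatrix, of_apply, Pi.add_apply]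
  ring

theorem vecDet_smul (c : ℂ) (v : Idx → ℂ) : vecDet (c • v) = c ^ 2 * vecDet v := by
  simp only [vecDet, Pi.smul_apply, smul_eq_mul]
  ring

theorem vecDet_antiVec (x y : ℂ) : vecDet (antiVec x y) = -(x * y) := by
  simp [vecDet, antiVec, ofCoeff]

theorem star_dotProduct_self (v : Idx → ℂ) : star v ⬝ᵥ v = (vecNormSq v : ℂ) := by
  rw [dotProduct, vecNormSq, Complex.ofReal_sum]
  exact Finset.sum_congr rfl fun a _ => by simpa using Complex.conj_mul' (v a)

theorem vecNormSq_eq (v : Idx → ℂ) :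
    vecNormSq v = ‖v (0, 0)‖ ^ 2 + ‖v (0, 1)‖ ^ 2 + ‖v (1, 0)‖ ^ 2 + ‖v (1, 1)‖ ^ 2 := by
  simp only [vecNormSq, Fintype.sum_prod_type, Fin.sum_univ_two]
  ring

theorem vecNormSq_pos {v : Idx → ℂ} (hv : v ≠ 0) : 0 < vecNormSq v := by
  obtain ⟨a, ha⟩ := Function.ne_iff.1 hv
  exact Finset.sum_pos' (fun _ _ => sq_nonneg _)
    ⟨a, Finset.mem_univ a, pow_pos (norm_pos_iff.2 ha) 2⟩

theorem vecNormSq_mulVec {P : Matrix Idx Idx ℂ} (hP : P ∈ unitaryGroup Idx ℂ) (v : Idx → ℂ) :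
    vecNormSq (P *ᵥ v) = vecNormSq v := by
  have h : star (P *ᵥ v) ⬝ᵥ P *ᵥ v = star v ⬝ᵥ v := by
    rw [star_mulVec, ← dotProduct_mulVec, mulVec_mulVec, ← star_eq_conjTranspose,
      mem_unitaryGroup_iff'.1 hP, one_mulVec]
  rw [star_dotProduct_self, star_dotProduct_self] at h
  exact_mod_cast h

theorem vecNormSq_antiVec (x y : ℂ) : vecNormSq (antiVec x y) = ‖x‖ ^ 2 + ‖y‖ ^ 2 := by
  simp [vecNormSq_eq, antiVec, ofCoeff]

theorem norm_vecDet_le (v : Idx → ℂ) : ‖vecDet v‖ ≤ vecNormSq v / 2 := by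
  have h := norm_sub_le (v (0, 0) * v (1, 1)) (v (0, 1) * v (1, 0))
  rw [norm_mul, norm_mul] at h
  rw [vecDet, vecNormSq_eq]
  nlinarith [sq_nonneg (‖v (0, 0)‖ - ‖v (1, 1)‖), sq_nonneg (‖v (0, 1)‖ - ‖v (1, 0)‖)]

theorem exists_schmidt {v : Idx → ℂ} (hv : vecDet v ≠ 0) :
    ∃ U ∈ unitaryGroup (Fin 2) ℂ, ∃ V ∈ unitaryGroup (Fin 2) ℂ, ∃ d : Fin 2 → ℝ, (∀ i, 0 < d i) ∧
      v = (U ⊗ₖ V) *ᵥ ofCoeff (diagonal fun i => (d i : ℂ)) := by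
  rw [← det_coeffMatrix] at hv
  obtain ⟨U, hU, S, hS, d, hd, h⟩ := exists_svd ((isUnit_iff_isUnit_det _).2 hv.isUnit)
  refine ⟨U, hU, Sᵀ, transpose_mem_unitaryGroup_iff.2 hS, d, hd, ?_⟩
  rw [kronecker_mulVec_ofCoeff, transpose_transpose, ← h, ofCoeff_coeffMatrix]

theorem exists_schmidt_antiVec {v : Idx → ℂ} (hv : vecDet v ≠ 0) :
    ∃ U ∈ unitaryGroup (Fin 2) ℂ, ∃ V ∈ unitaryGroup (Fin 2) ℂ, ∃ a b : ℝ, 0 < a ∧ 0 < b ∧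
      v = (U ⊗ₖ V) *ᵥ antiVec a b := by
  obtain ⟨U, hU, V, hV, d, hd, h⟩ := exists_schmidt hv
  refine ⟨U, hU, V.submatrix id (Equiv.swap 0 1), submatrix_equiv_mem_unitaryGroup hV _, d 0, d 1,
    hd 0, hd 1, ?_⟩
  rw [h, antiVec, kronecker_mulVec_ofCoeff, kronecker_mulVec_ofCoeff]
  congr 1
  ext i j
  simp [Matrix.mul_apply, Fin.sum_univ_two, add_comm]

end Vectors

section PartialTransposeForm

/-- The expectation value `⟨v|A^Γ|v⟩` of the partial transpose of `A`. -/
def ptForm (A : Matrix Idx Idx ℂ) (v : Idx → ℂ) : ℝ :=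
  (star v ⬝ᵥ partialTranspose A *ᵥ v).re

/-- The local conjugation `(P ⊗ Q) A (P ⊗ Q)ᴴ`; for unitary `P` and `Q` a local change of frame, for
invertible ones a local filtering operation. -/
def localConj (P Q : Matrix (Fin 2) (Fin 2) ℂ) (A : Matrix Idx Idx ℂ) : Matrix Idx Idx ℂ :=
  (P ⊗ₖ Q) * A * (P ⊗ₖ Q)ᴴ

theorem ptForm_add (A B : Matrix Idx Idx ℂ) (v : Idx → ℂ) :
    ptForm (A + B) v = ptForm A v + ptForm B v := by
  have h : partialTranspose (A + B) = partialTranspose A + partialTranspose B := rfl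
  rw [ptForm, h, add_mulVec, dotProduct_add, Complex.add_re, ptForm, ptForm]

theorem ptForm_smul (c : ℝ) (A : Matrix Idx Idx ℂ) (v : Idx → ℂ) :
    ptForm ((c : ℂ) • A) v = c * ptForm A v := by
  have h : partialTranspose ((c : ℂ) • A) = (c : ℂ) • partialTranspose A := rfl
  rw [ptForm, h, smul_mulVec, dotProduct_smul, smul_eq_mul, Complex.re_ofReal_mul, ptForm]

theorem ptForm_sum {ι : Type*} (s : Finset ι) (A : ι → Matrix Idx Idx ℂ) (v : Idx → ℂ) :
    ptForm (∑ i ∈ s, A i) v = ∑ i ∈ s, ptForm (A i) v := by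
  have h0 : ptForm 0 v = 0 := by simpa using ptForm_smul 0 0 v
  exact map_sum (⟨⟨fun A => ptForm A v, h0⟩, fun A B => ptForm_add A B v⟩ :
    Matrix Idx Idx ℂ →+ ℝ) A s

theorem ptForm_vec_smul (A : Matrix Idx Idx ℂ) (c : ℂ) (v : Idx → ℂ) :
    ptForm A (c • v) = ‖c‖ ^ 2 * ptForm A v := by
  rw [ptForm, star_smul, smul_dotProduct, mulVec_smul, dotProduct_smul, smul_eq_mul, smul_eq_mul,
    ← mul_assoc, RCLike.star_def, Complex.conj_mul', ← Complex.ofReal_pow, Complex.re_ofReal_mul,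
    ptForm]

theorem partialTranspose_localConj (P Q : Matrix (Fin 2) (Fin 2) ℂ) (A : Matrix Idx Idx ℂ) :
    partialTranspose (localConj P Q A) = localConj P (Q.map star) (partialTranspose A) := by
  ext a b
  simp only [localConj, partialTranspose, of_apply, Matrix.mul_apply, kroneckerMap_apply,
    conjTranspose_apply, map_apply, Fintype.sum_prod_type, Fin.sum_univ_two, star_mul', star_star]
  ring

theorem ptForm_localConj (P Q : Matrix (Fin 2) (Fin 2) ℂ) (A : Matrix Idx Idx ℂ) (v : Idx → ℂ) :
    ptForm (localConj P Q A) v = ptForm A ((Pᴴ ⊗ₖ Qᵀ) *ᵥ v) := by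
  have h : (P ⊗ₖ Q.map star)ᴴ = Pᴴ ⊗ₖ Qᵀ := by
    rw [conjTranspose_kronecker]
    congr 1
    ext i j
    simp
  rw [ptForm, ptForm, partialTranspose_localConj, localConj, h, star_mulVec, ← h,
    conjTranspose_conjTranspose, ← mulVec_mulVec, ← mulVec_mulVec, dotProduct_mulVec]

theorem localConj_localConj (P Q P' Q' : Matrix (Fin 2) (Fin 2) ℂ) (A : Matrix Idx Idx ℂ) :
    localConj P Q (localConj P' Q' A) = localConj (P * P') (Q * Q') A := by
  simp only [localConj, mul_kronecker_mul, conjTranspose_mul, Matrix.mul_assoc]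

theorem localConj_proj (P Q : Matrix (Fin 2) (Fin 2) ℂ) (v : Idx → ℂ) :
    localConj P Q (proj v) = proj ((P ⊗ₖ Q) *ᵥ v) := by
  rw [localConj, proj, mul_vecMulVec, vecMulVec_mul, proj, star_mulVec]

theorem posSemidef_localConj {A : Matrix Idx Idx ℂ} (hA : A.PosSemidef)
    (P Q : Matrix (Fin 2) (Fin 2) ℂ) : (localConj P Q A).PosSemidef :=
  hA.mul_mul_conjTranspose_same _

theorem trace_localConj {U V : Matrix (Fin 2) (Fin 2) ℂ} (hU : U ∈ unitaryGroup (Fin 2) ℂ)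
    (hV : V ∈ unitaryGroup (Fin 2) ℂ) (A : Matrix Idx Idx ℂ) :
    (localConj U V A).trace = A.trace := by
  have h : (U ⊗ₖ V)ᴴ * (U ⊗ₖ V) = 1 := mem_unitaryGroup_iff'.1 (kronecker_mem_unitary hU hV)
  rw [localConj, trace_mul_comm, ← Matrix.mul_assoc, h, Matrix.one_mul]

theorem mul_conjTranspose_eq_sum_proj {ι : Type*} [Fintype ι] (X : Matrix Idx ι ℂ) :
    X * Xᴴ = ∑ i, proj (Xᵀ i) := by
  ext a b
  simp [Matrix.mul_apply, Matrix.sum_apply, proj, vecMulVec_apply]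

end PartialTransposeForm

section LocalUnitaryEquiv

theorem localUnitaryEquiv_localConj {U V : Matrix (Fin 2) (Fin 2) ℂ}
    (hU : U ∈ unitaryGroup (Fin 2) ℂ) (hV : V ∈ unitaryGroup (Fin 2) ℂ) (A : Matrix Idx Idx ℂ) :
    LocalUnitaryEquiv (localConj U V A) A :=
  ⟨U, hU, V, hV, rfl⟩

theorem LocalUnitaryEquiv.symm {A B : Matrix Idx Idx ℂ} (h : LocalUnitaryEquiv A B) :
    LocalUnitaryEquiv B A := by
  obtain ⟨U, hU, V, hV, h⟩ := h
  refine ⟨Uᴴ, Unitary.star_mem hU, Vᴴ, Unitary.star_mem hV, ?_⟩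
  change B = localConj Uᴴ Vᴴ A
  rw [show A = localConj U V B from h, localConj_localConj,
    show Uᴴ * U = 1 from mem_unitaryGroup_iff'.1 hU,
    show Vᴴ * V = 1 from mem_unitaryGroup_iff'.1 hV]
  simp [localConj]

theorem LocalUnitaryEquiv.trans {A B C : Matrix Idx Idx ℂ} (h : LocalUnitaryEquiv A B)
    (h' : LocalUnitaryEquiv B C) : LocalUnitaryEquiv A C := by
  obtain ⟨U, hU, V, hV, h⟩ := h
  obtain ⟨U', hU', V', hV', h'⟩ := h'
  exact ⟨U * U', mul_mem hU hU', V * V', mul_mem hV hV',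
    h.trans ((congrArg _ h').trans (localConj_localConj U V U' V' C))⟩

theorem LocalUnitaryEquiv.exists_ptForm_eq {A B : Matrix Idx Idx ℂ} (h : LocalUnitaryEquiv A B)
    (v : Idx → ℂ) :
    ∃ w, ptForm A v = ptForm B w ∧ vecNormSq w = vecNormSq v ∧ ‖vecDet w‖ = ‖vecDet v‖ := by
  obtain ⟨U, hU, V, hV, h⟩ := h
  have hU' : Uᴴ ∈ unitaryGroup (Fin 2) ℂ := Unitary.star_mem hU
  have hV' := transpose_mem_unitaryGroup_iff.2 hV
  exact ⟨(Uᴴ ⊗ₖ Vᵀ) *ᵥ v, (congrArg (ptForm · v) h).trans (ptForm_localConj U V B v),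
    vecNormSq_mulVec (kronecker_mem_unitary hU' hV') v, norm_vecDet_kronecker_mulVec hU' hV' v⟩

end LocalUnitaryEquiv

section PosSemidef

variable {n : Type*} {B : Matrix n n ℂ}

theorem re_diag_nonneg (hB : B.PosSemidef) (i : n) : 0 ≤ (B i i).re :=
  (Complex.le_def.1 (hB.diag_nonneg (i := i))).1

theorem sq_norm_le_mul_re (hB : B.PosSemidef) (i j : n) :
    ‖B i j‖ ^ 2 ≤ (B i i).re * (B j j).re := by
  have h := (Complex.le_def.1 (hB.submatrix ![i, j]).det_nonneg).1
  have him : (B i i).im = 0 := Complex.conj_eq_iff_im.1 (hB.isHermitian.apply i i)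
  have hji : B i j * B j i = ((‖B i j‖ ^ 2 : ℝ) : ℂ) := by
    rw [← hB.isHermitian.apply j i]
    simpa using Complex.mul_conj' (B i j)
  simp only [det_fin_two, submatrix_apply, cons_val_zero, cons_val_one, hji, Complex.zero_re,
    Complex.sub_re, Complex.mul_re, Complex.ofReal_re, him] at h
  linarith

end PosSemidef

section Bell

/-- The matrix with spectral weights `p` on the Bell states. -/
noncomputable def bellDiagonal (p : Fin 4 → ℝ) : Matrix Idx Idx ℂ :=
  ∑ k, (p k : ℂ) • proj (bell k)

theorem inv_sqrt_two_mul_self : ((√2 : ℝ) : ℂ)⁻¹ * ((√2 : ℝ) : ℂ)⁻¹ = 1 / 2 := by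
  rw [← mul_inv, ← Complex.ofReal_mul, Real.mul_self_sqrt zero_le_two, Complex.ofReal_ofNat,
    one_div]

theorem star_bell_dotProduct (v : Idx → ℂ) (k : Fin 4) :
    star (bell k) ⬝ᵥ v = ((√2 : ℝ) : ℂ)⁻¹ * ![v (0, 0) + v (1, 1), v (0, 0) - v (1, 1),
      v (0, 1) + v (1, 0), v (0, 1) - v (1, 0)] k := by
  fin_cases k <;>
    simp [bell, ket, dotProduct, Fintype.sum_prod_type, Fin.sum_univ_two, Pi.single_apply] <;> ring

theorem sq_norm_star_bell_dotProduct (v : Idx → ℂ) (k : Fin 4) :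
    ‖star (bell k) ⬝ᵥ v‖ ^ 2 = ‖![v (0, 0) + v (1, 1), v (0, 0) - v (1, 1),
      v (0, 1) + v (1, 0), v (0, 1) - v (1, 0)] k‖ ^ 2 / 2 := by
  rw [star_bell_dotProduct, norm_mul, mul_pow, norm_inv, Complex.norm_real, inv_pow,
    Real.norm_of_nonneg (Real.sqrt_nonneg 2), Real.sq_sqrt zero_le_two]
  ring

theorem star_bell_dotProduct_bell (j k : Fin 4) :
    star (bell j) ⬝ᵥ bell k = if j = k then 1 else 0 := by
  have h := inv_sqrt_two_mul_self
  rw [star_bell_dotProduct]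
  fin_cases j <;> fin_cases k <;>
    simp [bell, ket] <;> linear_combination 2 * h

theorem vecNormSq_eq_sum_bell (v : Idx → ℂ) :
    vecNormSq v = ∑ k, ‖star (bell k) ⬝ᵥ v‖ ^ 2 := by
  have h := parallelogram_law_with_norm ℝ (v (0, 0)) (v (1, 1))
  have h' := parallelogram_law_with_norm ℝ (v (0, 1)) (v (1, 0))
  simp only [sq_norm_star_bell_dotProduct, vecNormSq_eq, Fin.sum_univ_four, cons_val]
  linarith

theorem two_mul_vecDet_eq_bell (v : Idx → ℂ) :
    2 * vecDet v = (star (bell 0) ⬝ᵥ v) ^ 2 - (star (bell 1) ⬝ᵥ v) ^ 2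
      - (star (bell 2) ⬝ᵥ v) ^ 2 + (star (bell 3) ⬝ᵥ v) ^ 2 := by
  simp only [star_bell_dotProduct, cons_val, vecDet]
  linear_combination (-4 * (v (0, 0) * v (1, 1) - v (0, 1) * v (1, 0))) * inv_sqrt_two_mul_self

theorem vecNormSq_bell (k : Fin 4) : vecNormSq (bell k) = 1 := by
  simp [vecNormSq_eq_sum_bell, star_bell_dotProduct_bell, apply_ite]

theorem norm_vecDet_bell (k : Fin 4) : ‖vecDet (bell k)‖ = 1 / 2 := by
  have h : ‖2 * vecDet (bell k)‖ = 1 := by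
    rw [two_mul_vecDet_eq_bell]
    fin_cases k <;> simp [star_bell_dotProduct_bell]
  rw [norm_mul, Complex.norm_ofNat] at h
  linarith

theorem sq_norm_star_bell_dotProduct_le (v : Idx → ℂ) (k : Fin 4) :
    ‖star (bell k) ⬝ᵥ v‖ ^ 2 ≤ ‖vecDet v‖ + vecNormSq v / 2 := by
  have key : ∀ a b c d : ℂ, 2 * vecDet v = a + b + c + d →
      ‖a‖ ≤ 2 * ‖vecDet v‖ + ‖b‖ + ‖c‖ + ‖d‖ := fun a b c d h => by
    have he : a = 2 * vecDet v - b - c - d := by rw [h]; ring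
    rw [← Complex.norm_ofNat 2, ← norm_mul]
    calc ‖a‖ ≤ ‖2 * vecDet v - b - c‖ + ‖d‖ := he ▸ norm_sub_le _ _
      _ ≤ ‖2 * vecDet v - b‖ + ‖c‖ + ‖d‖ := by gcongr; exact norm_sub_le _ _
      _ ≤ ‖2 * vecDet v‖ + ‖b‖ + ‖c‖ + ‖d‖ := by gcongr; exact norm_sub_le _ _
  have hd := two_mul_vecDet_eq_bell v
  rw [vecNormSq_eq_sum_bell, Fin.sum_univ_four]
  set q := fun k => star (bell k) ⬝ᵥ v
  change 2 * vecDet v = q 0 ^ 2 - q 1 ^ 2 - q 2 ^ 2 + q 3 ^ 2 at hd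
  change ‖q k‖ ^ 2 ≤ ‖vecDet v‖ + (‖q 0‖ ^ 2 + ‖q 1‖ ^ 2 + ‖q 2‖ ^ 2 + ‖q 3‖ ^ 2) / 2
  have h0 := key (q 0 ^ 2) (-q 1 ^ 2) (-q 2 ^ 2) (q 3 ^ 2) (by rw [hd]; ring)
  have h1 := key (-q 1 ^ 2) (q 0 ^ 2) (-q 2 ^ 2) (q 3 ^ 2) (by rw [hd]; ring)
  have h2 := key (-q 2 ^ 2) (q 0 ^ 2) (-q 1 ^ 2) (q 3 ^ 2) (by rw [hd]; ring)
  have h3 := key (q 3 ^ 2) (q 0 ^ 2) (-q 1 ^ 2) (-q 2 ^ 2) (by rw [hd]; ring)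
  simp only [norm_neg, norm_pow] at h0 h1 h2 h3
  fin_cases k <;> simp only [Fin.zero_eta, Fin.mk_one, Fin.reduceFinMk] <;> linarith

theorem partialTranspose_proj_bell (k : Fin 4) :
    partialTranspose (proj (bell k)) = (1 / 2 : ℂ) • 1 - proj (bell k.rev) := by
  have hs := inv_sqrt_two_mul_self
  ext ⟨a, a'⟩ ⟨b, b'⟩
  fin_cases k <;> fin_cases a <;> fin_cases a' <;> fin_cases b <;> fin_cases b' <;>
    simp [partialTranspose, proj, vecMulVec_apply, bell, ket, Pi.single_apply, hs, Fin.rev]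

theorem ptForm_proj_bell (k : Fin 4) (v : Idx → ℂ) :
    ptForm (proj (bell k)) v = vecNormSq v / 2 - ‖star (bell k.rev) ⬝ᵥ v‖ ^ 2 := by
  have h : star v ⬝ᵥ proj (bell k.rev) *ᵥ v = ((‖star (bell k.rev) ⬝ᵥ v‖ ^ 2 : ℝ) : ℂ) := by
    rw [proj, vecMulVec_mulVec, op_smul_eq_smul, dotProduct_smul, smul_eq_mul, star_dotProduct v,
      RCLike.star_def, Complex.mul_conj', Complex.ofReal_pow]
  rw [ptForm, partialTranspose_proj_bell, sub_mulVec, smul_mulVec, one_mulVec, dotProduct_sub, h,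
    dotProduct_smul, star_dotProduct_self, Complex.sub_re, Complex.ofReal_re, smul_eq_mul,
    ← Complex.ofReal_ofNat, ← Complex.ofReal_one, ← Complex.ofReal_div, Complex.re_ofReal_mul,
    Complex.ofReal_re]
  ring

theorem ptForm_bellDiagonal (p : Fin 4 → ℝ) (v : Idx → ℂ) :
    ptForm (bellDiagonal p) v =
      (∑ k, p k) / 2 * vecNormSq v - ∑ k, p k * ‖star (bell k.rev) ⬝ᵥ v‖ ^ 2 := by
  simp only [bellDiagonal, ptForm_sum, ptForm_smul, ptForm_proj_bell, mul_sub,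
    Finset.sum_sub_distrib, ← Finset.sum_mul]
  ring

theorem ptForm_bellDiagonal_bell (p : Fin 4 → ℝ) (k : Fin 4) :
    ptForm (bellDiagonal p) (bell k.rev) = (∑ j, p j) / 2 - p k := by
  simp [ptForm_bellDiagonal, vecNormSq_bell, star_bell_dotProduct_bell, apply_ite]

theorem neg_ptForm_bellDiagonal_le {p : Fin 4 → ℝ} (hp : ∀ k, 0 ≤ p k) {m : Fin 4}
    (hm : ∀ k, p k ≤ p m) (v : Idx → ℂ) :
    -ptForm (bellDiagonal p) v ≤ max 0 (2 * p m - ∑ k, p k) * ‖vecDet v‖ := by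
  have hn : ∑ k : Fin 4, ‖star (bell k.rev) ⬝ᵥ v‖ ^ 2 = vecNormSq v := by
    rw [vecNormSq_eq_sum_bell]
    exact Equiv.sum_comp Fin.revPerm fun k => ‖star (bell k) ⬝ᵥ v‖ ^ 2
  have hr := fun k : Fin 4 => sq_nonneg ‖star (bell k.rev) ⬝ᵥ v‖
  rw [ptForm_bellDiagonal]
  rcases le_total (2 * p m) (∑ k, p k) with h | h
  · rw [max_eq_left (by linarith), zero_mul, neg_sub, sub_nonpos, ← hn, Finset.mul_sum]
    exact Finset.sum_le_sum fun k _ => mul_le_mul_of_nonneg_right (by linarith [hm k]) (hr k)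
  · have hle : ∀ k, p k * ‖star (bell k.rev) ⬝ᵥ v‖ ^ 2 ≤
        (∑ j, p j - p m) * ‖star (bell k.rev) ⬝ᵥ v‖ ^ 2 +
          if k = m then (2 * p m - ∑ j, p j) * ‖star (bell m.rev) ⬝ᵥ v‖ ^ 2 else 0 := fun k => by
      split_ifs with hk
      · rw [hk]
        linarith
      · have hkm := Finset.add_le_sum (fun j _ => hp j) (Finset.mem_univ k) (Finset.mem_univ m) hk
        rw [add_zero]
        exact mul_le_mul_of_nonneg_right (by linarith) (hr k)
    have hsum := Finset.sum_le_sum fun k (_ : k ∈ Finset.univ) => hle k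
    rw [Finset.sum_add_distrib, ← Finset.mul_sum, hn, Finset.sum_ite_eq' Finset.univ m,
      if_pos (Finset.mem_univ m)] at hsum
    have hmax := mul_le_mul_of_nonneg_left (sq_norm_star_bell_dotProduct_le v m.rev)
      (sub_nonneg.2 h)
    rw [max_eq_right (by linarith)]
    linarith

end Bell

section BellNormalForm

/-- The real Pauli matrices `1, σ_z, σ_x, i σ_y`: up to the factor `√2`, the coefficient matrices of
the Bell states, in the same order. -/
def realPauli : Fin 4 → Matrix (Fin 2) (Fin 2) ℂ :=
  ![1, !![1, 0; 0, -1], !![0, 1; 1, 0], !![0, 1; -1, 0]]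

theorem coeffMatrix_bell (k : Fin 4) :
    coeffMatrix (bell k) = ((√2 : ℝ) : ℂ)⁻¹ • realPauli k := by
  ext i j
  fin_cases k <;> fin_cases i <;> fin_cases j <;> simp [coeffMatrix, bell, ket, realPauli]

theorem polarDet_one (X : Matrix (Fin 2) (Fin 2) ℂ) : polarDet 1 X = X.trace := by
  simp [polarDet, trace_fin_two, add_comm]

theorem polarDet_self (X : Matrix (Fin 2) (Fin 2) ℂ) : polarDet X X = 2 * X.det := by
  rw [polarDet, det_fin_two]
  ring

theorem polarDet_comm (X Y : Matrix (Fin 2) (Fin 2) ℂ) : polarDet X Y = polarDet Y X := by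
  simp only [polarDet]
  ring

theorem polarDet_mul_mul (P Q X Y : Matrix (Fin 2) (Fin 2) ℂ) :
    polarDet (P * X * Q) (P * Y * Q) = P.det * Q.det * polarDet X Y := by
  simp only [polarDet, Matrix.mul_apply, Fin.sum_univ_two, det_fin_two]
  ring

theorem polarDet_smul_left (c : ℂ) (X Y : Matrix (Fin 2) (Fin 2) ℂ) :
    polarDet (c • X) Y = c * polarDet X Y := by
  simp only [polarDet, Matrix.smul_apply, smul_eq_mul]
  ring

theorem polarDet_conj {S : Matrix (Fin 2) (Fin 2) ℂ} (hS : IsUnit S.det)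
    (X Y : Matrix (Fin 2) (Fin 2) ℂ) :
    polarDet (S⁻¹ * X * S) (S⁻¹ * Y * S) = polarDet X Y := by
  rw [polarDet_mul_mul, ← det_mul, nonsing_inv_mul _ hS, det_one, one_mul]

theorem exists_conj_eq_smul_realPauli_one {K : Matrix (Fin 2) (Fin 2) ℂ} (hK : K.trace = 0)
    (hK0 : K.det ≠ 0) :
    ∃ S : Matrix (Fin 2) (Fin 2) ℂ, IsUnit S.det ∧
      ∃ κ : ℂ, κ ≠ 0 ∧ S⁻¹ * K * S = κ • realPauli 1 := by
  suffices ∃ κ : ℂ, κ ≠ 0 ∧ ∃ S : Matrix (Fin 2) (Fin 2) ℂ, S.det ≠ 0 ∧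
      K * S = S * (κ • realPauli 1) by
    obtain ⟨κ, hκ0, S, hS, h⟩ := this
    refine ⟨S, hS.isUnit, κ, hκ0, ?_⟩
    rw [Matrix.mul_assoc, h, nonsing_inv_mul_cancel_left _ _ hS.isUnit]
  have hK11 : K 1 1 = -K 0 0 := by
    rw [trace_fin_two] at hK
    linear_combination hK
  rw [det_fin_two, hK11] at hK0
  -- in both cases the columns of `S` are eigenvectors of `K` for the eigenvalues `κ` and `-κ`
  by_cases hb : K 0 1 = 0
  · have ha : K 0 0 ≠ 0 := fun h => by simp [h, hb] at hK0
    refine ⟨K 0 0, ha, !![2 * K 0 0, 0; K 1 0, 1], by simpa using ha, ?_⟩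
    ext i j
    fin_cases i <;> fin_cases j <;>
      simp [Matrix.mul_apply, Fin.sum_univ_two, realPauli, hb, hK11] <;> ring
  · obtain ⟨κ, hκ⟩ := IsAlgClosed.exists_eq_mul_self (K 0 0 * K 0 0 + K 0 1 * K 1 0)
    have hκ0 : κ ≠ 0 := by
      rintro rfl
      exact hK0 (by linear_combination -hκ)
    refine ⟨κ, hκ0, !![K 0 1, K 0 1; κ - K 0 0, -κ - K 0 0], ?_, ?_⟩
    · have hdet : -2 * (K 0 1 * κ) ≠ 0 := mul_ne_zero (by norm_num) (mul_ne_zero hb hκ0)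
      rw [det_fin_two_of]
      convert hdet using 1
      ring
    · ext i j
      fin_cases i <;> fin_cases j <;>
        simp [Matrix.mul_apply, Fin.sum_univ_two, realPauli, hK11] <;> grind

theorem exists_commute_conj_eq_smul_realPauli_two {L : Matrix (Fin 2) (Fin 2) ℂ}
    (h0 : polarDet (realPauli 0) L = 0) (h1 : polarDet (realPauli 1) L = 0) (hL : L.det ≠ 0) :
    ∃ S : Matrix (Fin 2) (Fin 2) ℂ, IsUnit S.det ∧ Commute (realPauli 1) S ∧
      ∃ c : ℂ, c ≠ 0 ∧ S⁻¹ * L * S = c • realPauli 2 := by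
  simp only [polarDet, realPauli, Matrix.cons_val] at h0 h1
  norm_num at h0 h1
  have h00 : L 0 0 = 0 := by linear_combination h0 / 2 - h1 / 2
  have h11 : L 1 1 = 0 := by linear_combination h0 / 2 + h1 / 2
  rw [det_fin_two, h00, zero_mul, zero_sub, neg_ne_zero, mul_ne_zero_iff] at hL
  obtain ⟨r, hr⟩ := IsAlgClosed.exists_eq_mul_self (L 1 0 / L 0 1)
  have hr0 : r ≠ 0 := by
    rintro rfl
    exact div_ne_zero hL.2 hL.1 (by simpa using hr)
  have hS : IsUnit (!![1, 0; 0, r] : Matrix (Fin 2) (Fin 2) ℂ).det := by simpa using hr0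
  refine ⟨!![1, 0; 0, r], hS, ?_, L 0 1 * r, mul_ne_zero hL.1 hr0, ?_⟩
  · ext i j
    fin_cases i <;> fin_cases j <;> simp [Matrix.mul_apply, Fin.sum_univ_two, realPauli]
  · suffices L * !![1, 0; 0, r] = !![1, 0; 0, r] * ((L 0 1 * r) • realPauli 2) by
      rw [Matrix.mul_assoc, this, nonsing_inv_mul_cancel_left _ _ hS]
    rw [div_eq_iff hL.1] at hr
    ext i j
    fin_cases i <;> fin_cases j <;>
      simp [Matrix.mul_apply, Fin.sum_univ_two, realPauli, h00, h11]
    linear_combination hr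

theorem exists_eq_smul_realPauli_three {N : Matrix (Fin 2) (Fin 2) ℂ}
    (h0 : polarDet (realPauli 0) N = 0) (h1 : polarDet (realPauli 1) N = 0)
    (h2 : polarDet (realPauli 2) N = 0) :
    ∃ c : ℂ, N = c • realPauli 3 := by
  simp only [polarDet, realPauli, Matrix.cons_val] at h0 h1 h2
  norm_num at h0 h1 h2
  refine ⟨N 0 1, ?_⟩
  ext i j
  fin_cases i <;> fin_cases j <;> simp [realPauli]
  · linear_combination h0 / 2 - h1 / 2
  · linear_combination -h2
  · linear_combination h0 / 2 + h1 / 2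

theorem exists_conj_eq_smul_realPauli {K : Fin 4 → Matrix (Fin 2) (Fin 2) ℂ} (h1 : K 0 = 1)
    (hK : Pairwise fun i j => polarDet (K i) (K j) = 0) (hdet : ∀ i, (K i).det ≠ 0) :
    ∃ S : Matrix (Fin 2) (Fin 2) ℂ, IsUnit S.det ∧
      ∀ i, ∃ c : ℂ, S⁻¹ * K i * S = c • realPauli i := by
  have orth {S : Matrix (Fin 2) (Fin 2) ℂ} (hS : IsUnit S.det) {i j : Fin 4} (hij : i ≠ j)
      {κ : ℂ} (hκ : κ ≠ 0) (hi : S⁻¹ * K i * S = κ • realPauli i) :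
      polarDet (realPauli i) (S⁻¹ * K j * S) = 0 := by
    have h := (polarDet_conj hS (K i) (K j)).trans (hK hij)
    rw [hi, polarDet_smul_left] at h
    exact (mul_eq_zero.1 h).resolve_left hκ
  have conj_zero {S : Matrix (Fin 2) (Fin 2) ℂ} (hS : IsUnit S.det) :
      S⁻¹ * K 0 * S = (1 : ℂ) • realPauli 0 := by
    rw [h1, Matrix.mul_one, nonsing_inv_mul _ hS, one_smul]
    rfl
  obtain ⟨S, hS, κ, hκ, hS1⟩ := exists_conj_eq_smul_realPauli_one (K := K 1)
    (by rw [← polarDet_one, ← h1]; exact hK (by decide)) (hdet 1)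
  obtain ⟨D, hD, hcomm, c, hc, hD2⟩ := exists_commute_conj_eq_smul_realPauli_two
    (orth hS (j := 2) (by decide) one_ne_zero (conj_zero hS)) (orth hS (by decide) hκ hS1)
    (by rw [det_mul, det_mul, mul_right_comm, ← det_mul, nonsing_inv_mul _ hS, det_one, one_mul]
        exact hdet 2)
  have hSD : IsUnit (S * D).det := by
    rw [det_mul]
    exact hS.mul hD
  have conj_mul (i : Fin 4) : (S * D)⁻¹ * K i * (S * D) = D⁻¹ * (S⁻¹ * K i * S) * D := by
    simp only [Matrix.mul_inv_rev, Matrix.mul_assoc]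
  have hSD1 : (S * D)⁻¹ * K 1 * (S * D) = κ • realPauli 1 := by
    rw [conj_mul, hS1, Matrix.mul_smul, Matrix.smul_mul, Matrix.mul_assoc, hcomm.eq,
      nonsing_inv_mul_cancel_left _ _ hD]
  have hSD2 := (conj_mul 2).trans hD2
  refine ⟨S * D, hSD, fun i => ?_⟩
  fin_cases i
  · exact ⟨1, conj_zero hSD⟩
  · exact ⟨κ, hSD1⟩
  · exact ⟨c, hSD2⟩
  · exact exists_eq_smul_realPauli_three (orth hSD (j := 3) (by decide) one_ne_zero (conj_zero hSD))
      (orth hSD (by decide) hκ hSD1) (orth hSD (by decide) hc hSD2)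

theorem exists_eq_smul_mul_realPauli_mul {X : Fin 4 → Matrix (Fin 2) (Fin 2) ℂ}
    (hX : Pairwise fun i j => polarDet (X i) (X j) = 0) (hdet : ∀ i, (X i).det ≠ 0) :
    ∃ P Q : Matrix (Fin 2) (Fin 2) ℂ, IsUnit P.det ∧ IsUnit Q.det ∧
      ∀ i, ∃ c : ℂ, X i = c • (P * realPauli i * Q) := by
  have hX0 : IsUnit (X 0).det := (hdet 0).isUnit
  have hinv : IsUnit (X 0)⁻¹.det := by rwa [isUnit_nonsing_inv_det_iff]
  obtain ⟨S, hS, h⟩ := exists_conj_eq_smul_realPauli (K := fun i => (X 0)⁻¹ * X i)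
    (nonsing_inv_mul _ hX0)
    (fun i j hij => by
      simpa [hX hij] using polarDet_mul_mul (X 0)⁻¹ 1 (X i) (X j))
    (fun i => by
      rw [det_mul]
      exact mul_ne_zero hinv.ne_zero (hdet i))
  refine ⟨X 0 * S, S⁻¹, by rw [det_mul]; exact hX0.mul hS, by rwa [isUnit_nonsing_inv_det_iff],
    fun i => (h i).imp fun c hc => ?_⟩
  have hi : X i = X 0 * S * (S⁻¹ * ((X 0)⁻¹ * X i) * S) * S⁻¹ := by
    simp only [Matrix.mul_assoc, mul_nonsing_inv _ hS, Matrix.mul_one,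
      mul_nonsing_inv_cancel_left _ _ hS, mul_nonsing_inv_cancel_left _ _ hX0]
  rw [hi, hc, Matrix.mul_smul, Matrix.smul_mul]

theorem transpose_mul_spinFlip_mul_apply {ι : Type*} (X : Matrix Idx ι ℂ) (i j : ι) :
    (Xᵀ * (pauliY ⊗ₖ pauliY) * X) i j = -polarDet (coeffMatrix (Xᵀ i)) (coeffMatrix (Xᵀ j)) := by
  simp only [Matrix.mul_apply, Fintype.sum_prod_type, Fin.sum_univ_two, kronecker_apply, pauliY,
    polarDet, coeffMatrix, of_apply, transpose_apply, cons_val', cons_val_zero, cons_val_one,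
    cons_val_fin_one]
  linear_combination (X (0, 0) i * X (1, 1) j + X (1, 1) i * X (0, 0) j - X (0, 1) i * X (1, 0) j -
    X (1, 0) i * X (0, 1) j) * Complex.I_mul_I

theorem ofCoeff_smul (c : ℂ) (M : Matrix (Fin 2) (Fin 2) ℂ) : ofCoeff (c • M) = c • ofCoeff M := rfl

theorem sqrt_two_smul_bell (k : Fin 4) :
    ((√2 : ℝ) : ℂ) • bell k = ofCoeff (realPauli k) := by
  have h2 : ((√2 : ℝ) : ℂ) ≠ 0 := by simp
  rw [← ofCoeff_coeffMatrix (bell k), coeffMatrix_bell, ← ofCoeff_smul, smul_inv_smul₀ h2]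

theorem proj_smul (c : ℂ) (v : Idx → ℂ) : proj (c • v) = ((‖c‖ ^ 2 : ℝ) : ℂ) • proj v := by
  rw [proj, star_smul, smul_vecMulVec, vecMulVec_smul, smul_smul, RCLike.star_def,
    Complex.mul_conj', ← Complex.ofReal_pow, proj]

theorem localConj_bellDiagonal (P Q : Matrix (Fin 2) (Fin 2) ℂ) (p : Fin 4 → ℝ) :
    localConj P Q (bellDiagonal p) = ∑ k, (p k : ℂ) • proj ((P ⊗ₖ Q) *ᵥ bell k) := by
  simp only [← localConj_proj, localConj, bellDiagonal, Finset.mul_sum, Finset.sum_mul,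
    Matrix.mul_smul, Matrix.smul_mul]

theorem exists_bell_normal_form {X : Matrix Idx (Fin 4) ℂ} {l : Fin 4 → ℝ} (hl : ∀ i, 0 < l i)
    (h : Xᵀ * (pauliY ⊗ₖ pauliY) * X = diagonal fun i => (l i : ℂ)) :
    ∃ P Q : Matrix (Fin 2) (Fin 2) ℂ, IsUnit P.det ∧ IsUnit Q.det ∧ ∃ p : Fin 4 → ℝ,
      (∀ i, l i = ‖P.det * Q.det‖ * p i) ∧ X * Xᴴ = localConj P Q (bellDiagonal p) := by
  have hpolar (i j : Fin 4) : polarDet (coeffMatrix (Xᵀ i)) (coeffMatrix (Xᵀ j)) =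
      -(diagonal fun i => (l i : ℂ)) i j := by
    rw [← h, transpose_mul_spinFlip_mul_apply, neg_neg]
  have hdet (i : Fin 4) : 2 * vecDet (Xᵀ i) = -(l i : ℂ) := by
    rw [← det_coeffMatrix, ← polarDet_self, hpolar, diagonal_apply_eq]
  have hdet0 (i : Fin 4) : (coeffMatrix (Xᵀ i)).det ≠ 0 := fun h0 => by
    have := hdet i
    rw [← det_coeffMatrix, h0, mul_zero, eq_comm, neg_eq_zero, Complex.ofReal_eq_zero] at this
    exact (hl i).ne' this
  obtain ⟨P, Q, hP, hQ, hX⟩ := exists_eq_smul_mul_realPauli_mul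
    (fun i j hij => (hpolar i j).trans (by rw [diagonal_apply_ne _ hij, neg_zero])) hdet0
  choose c hc using hX
  have hcol (i : Fin 4) : Xᵀ i = (c i * ((√2 : ℝ) : ℂ)) • ((P ⊗ₖ Qᵀ) *ᵥ bell i) := by
    rw [mul_smul, ← mulVec_smul, sqrt_two_smul_bell, kronecker_mulVec_ofCoeff, ← ofCoeff_smul,
      transpose_transpose, ← hc, ofCoeff_coeffMatrix]
  refine ⟨P, Qᵀ, hP, by rwa [det_transpose], fun i => ‖c i * ((√2 : ℝ) : ℂ)‖ ^ 2, fun i => ?_, ?_⟩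
  · have hi := congrArg norm (hdet i)
    rw [hcol, vecDet_smul, vecDet_kronecker_mulVec, norm_neg, Complex.norm_of_nonneg (hl i).le,
      norm_mul, norm_mul, norm_mul _ (vecDet _), norm_vecDet_bell, norm_pow] at hi
    rw [← hi, Complex.norm_ofNat]
    ring
  · simp only [mul_conjTranspose_eq_sum_proj, localConj_bellDiagonal, hcol, proj_smul]

theorem norm_vecDet_conjTranspose_kronecker_transpose_mulVec (P Q : Matrix (Fin 2) (Fin 2) ℂ)
    (v : Idx → ℂ) : ‖vecDet ((Pᴴ ⊗ₖ Qᵀ) *ᵥ v)‖ = ‖P.det * Q.det‖ * ‖vecDet v‖ := by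
  rw [vecDet_kronecker_mulVec, det_conjTranspose, det_transpose, norm_mul, norm_mul, norm_star,
    norm_mul]

theorem neg_ptForm_mul_conjTranspose_le {X : Matrix Idx (Fin 4) ℂ} {l : Fin 4 → ℝ}
    (hanti : Antitone l) (hl : ∀ i, 0 < l i)
    (h : Xᵀ * (pauliY ⊗ₖ pauliY) * X = diagonal fun i => (l i : ℂ)) (v : Idx → ℂ) :
    -ptForm (X * Xᴴ) v ≤ max 0 (l 0 - l 1 - l 2 - l 3) * ‖vecDet v‖ := by
  obtain ⟨P, Q, hP, hQ, p, hlp, hX⟩ := exists_bell_normal_form hl h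
  have hκ : 0 < ‖P.det * Q.det‖ := norm_pos_iff.2 (mul_ne_zero hP.ne_zero hQ.ne_zero)
  have hp (k : Fin 4) : 0 ≤ p k := (pos_of_mul_pos_right (hlp k ▸ hl k) hκ.le).le
  have hp0 (k : Fin 4) : p k ≤ p 0 := by
    have := hanti (Fin.zero_le k)
    rw [hlp, hlp] at this
    exact le_of_mul_le_mul_left this hκ
  have hsum : l 0 - l 1 - l 2 - l 3 = ‖P.det * Q.det‖ * (2 * p 0 - ∑ k, p k) := by
    simp only [hlp, Fin.sum_univ_four]
    ring
  calc -ptForm (X * Xᴴ) v = -ptForm (bellDiagonal p) ((Pᴴ ⊗ₖ Qᵀ) *ᵥ v) := by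
        rw [hX, ptForm_localConj]
    _ ≤ max 0 (2 * p 0 - ∑ k, p k) * ‖vecDet ((Pᴴ ⊗ₖ Qᵀ) *ᵥ v)‖ :=
        neg_ptForm_bellDiagonal_le hp hp0 _
    _ = max 0 (l 0 - l 1 - l 2 - l 3) * ‖vecDet v‖ := by
        rw [norm_vecDet_conjTranspose_kronecker_transpose_mulVec, hsum,
          ← mul_zero ‖P.det * Q.det‖, ← mul_max_of_nonneg _ _ hκ.le, mul_zero]
        ring

theorem exists_neg_ptForm_mul_conjTranspose_eq {X : Matrix Idx (Fin 4) ℂ} {l : Fin 4 → ℝ}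
    (hl : ∀ i, 0 < l i) (h : Xᵀ * (pauliY ⊗ₖ pauliY) * X = diagonal fun i => (l i : ℂ)) :
    ∃ v, vecDet v ≠ 0 ∧ -ptForm (X * Xᴴ) v = (l 0 - l 1 - l 2 - l 3) * ‖vecDet v‖ := by
  obtain ⟨P, Q, hP, hQ, p, hlp, hX⟩ := exists_bell_normal_form hl h
  have hv : (Pᴴ ⊗ₖ Qᵀ) *ᵥ ((Pᴴ)⁻¹ ⊗ₖ (Qᵀ)⁻¹) *ᵥ bell 3 = bell 3 := by
    rw [mulVec_mulVec, ← mul_kronecker_mul,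
      mul_nonsing_inv _ (by rw [det_conjTranspose]; exact hP.star),
      mul_nonsing_inv _ (by rwa [det_transpose]), one_kronecker_one, one_mulVec]
  have hdet := norm_vecDet_conjTranspose_kronecker_transpose_mulVec P Q
    (((Pᴴ)⁻¹ ⊗ₖ (Qᵀ)⁻¹) *ᵥ bell 3)
  rw [hv, norm_vecDet_bell] at hdet
  refine ⟨((Pᴴ)⁻¹ ⊗ₖ (Qᵀ)⁻¹) *ᵥ bell 3, fun h0 => by norm_num [h0] at hdet, ?_⟩
  have hform : ptForm (bellDiagonal p) (bell 3) = (∑ j, p j) / 2 - p 0 :=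
    ptForm_bellDiagonal_bell p 0
  rw [hX, ptForm_localConj, hv, hform, hlp, hlp, hlp, hlp, Fin.sum_univ_four]
  linear_combination (p 0 - p 1 - p 2 - p 3) * hdet

end BellNormalForm

section CrossConcurrence

/-- The quantity `2 (|B₀₀,₁₁| - √(B₀₁,₀₁ B₁₀,₁₀))`, a lower bound for the concurrence of a state `B`
in every local frame; if the concurrence is positive, some local frame attains it. -/
noncomputable def crossConcurrence (B : Matrix Idx Idx ℂ) : ℝ :=
  2 * ‖B (0, 0) (1, 1)‖ - 2 * √((B (0, 1) (0, 1)).re * (B (1, 0) (1, 0)).re)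

theorem continuous_crossConcurrence : Continuous crossConcurrence := by
  unfold crossConcurrence
  fun_prop

theorem ptForm_antiVec {B : Matrix Idx Idx ℂ} (hB : B.IsHermitian) (x y : ℂ) :
    ptForm B (antiVec x y) = ‖x‖ ^ 2 * (B (0, 1) (0, 1)).re + ‖y‖ ^ 2 * (B (1, 0) (1, 0)).re +
      2 * (star x * y * B (0, 0) (1, 1)).re := by
  have hH : B (1, 1) (0, 0) = star (B (0, 0) (1, 1)) := (hB.apply _ _).symm
  have h00 : antiVec x y (0, 0) = 0 := rfl
  have h01 : antiVec x y (0, 1) = x := rfl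
  have h10 : antiVec x y (1, 0) = y := rfl
  have h11 : antiVec x y (1, 1) = 0 := rfl
  simp [ptForm, mulVec, dotProduct, Fintype.sum_prod_type, partialTranspose, h00, h01, h10, h11, hH,
    Complex.sq_norm, Complex.normSq_apply]
  ring

theorem neg_ptForm_antiVec_le {B : Matrix Idx Idx ℂ} (hB : B.PosSemidef) (x y : ℂ) :
    -ptForm B (antiVec x y) ≤ ‖x‖ * ‖y‖ * crossConcurrence B := by
  have hp := re_diag_nonneg hB (0, 1)
  have hs := re_diag_nonneg hB (1, 0)
  have hr : -(star x * y * B (0, 0) (1, 1)).re ≤ ‖x‖ * ‖y‖ * ‖B (0, 0) (1, 1)‖ := by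
    refine (neg_le_abs _).trans ((Complex.abs_re_le_norm _).trans_eq ?_)
    rw [norm_mul, norm_mul, norm_star]
  rw [ptForm_antiVec hB.isHermitian, crossConcurrence, Real.sqrt_mul hp]
  nlinarith [sq_nonneg (‖x‖ * √(B (0, 1) (0, 1)).re - ‖y‖ * √(B (1, 0) (1, 0)).re),
    Real.sq_sqrt hp, Real.sq_sqrt hs]

theorem exists_neg_ptForm_le_crossConcurrence {B : Matrix Idx Idx ℂ} (hB : B.PosSemidef)
    {v : Idx → ℂ} (hv : vecDet v ≠ 0) :
    ∃ U ∈ unitaryGroup (Fin 2) ℂ, ∃ V ∈ unitaryGroup (Fin 2) ℂ,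
      -ptForm B v ≤ ‖vecDet v‖ * crossConcurrence (localConj U V B) := by
  obtain ⟨U, hU, V, hV, a, b, -, -, rfl⟩ := exists_schmidt_antiVec hv
  refine ⟨Uᴴ, Unitary.star_mem hU, Vᵀ, transpose_mem_unitaryGroup_iff.2 hV, ?_⟩
  have h := neg_ptForm_antiVec_le (posSemidef_localConj hB Uᴴ Vᵀ) a b
  rwa [ptForm_localConj, conjTranspose_conjTranspose, transpose_transpose, ← norm_mul,
    ← norm_neg (_ * _), ← vecDet_antiVec, ← norm_vecDet_kronecker_mulVec hU hV] at h

end CrossConcurrence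

section WoottersDecomposition

/-- The columns of `X` are orthogonal for the spin-flip form with values `l` (Wootters'
decomposition of `X Xᴴ`), and `U`, `V` is a local frame in which the cross concurrence of `X Xᴴ`
reaches `l 0 - l 1 - l 2 - l 3`, the smallest constant that the bound on `ptForm` allows. -/
structure IsOptimalDecomposition (X : Matrix Idx (Fin 4) ℂ) (U V : Matrix (Fin 2) (Fin 2) ℂ)
    (l : Fin 4 → ℝ) : Prop where
  diagonal_eq : Xᵀ * (pauliY ⊗ₖ pauliY) * X = diagonal fun i => (l i : ℂ)
  antitone : Antitone l
  nonneg : ∀ i, 0 ≤ l i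
  neg_ptForm_le : ∀ v, -ptForm (X * Xᴴ) v ≤ max 0 (l 0 - l 1 - l 2 - l 3) * ‖vecDet v‖
  le_crossConcurrence : l 0 - l 1 - l 2 - l 3 ≤ crossConcurrence (localConj U V (X * Xᴴ))

theorem transpose_transpose_mul_mul_self {T : Matrix Idx (Fin 4) ℂ} :
    (Tᵀ * (pauliY ⊗ₖ pauliY) * T)ᵀ = Tᵀ * (pauliY ⊗ₖ pauliY) * T := by
  ext i j
  rw [transpose_apply, transpose_mul_spinFlip_mul_apply, transpose_mul_spinFlip_mul_apply,
    polarDet_comm]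

theorem exists_isOptimalDecomposition_of_isUnit {T : Matrix Idx (Fin 4) ℂ}
    (hT : IsUnit (Tᵀ * (pauliY ⊗ₖ pauliY) * T)) :
    ∃ W ∈ unitaryGroup (Fin 4) ℂ, ∃ U ∈ unitaryGroup (Fin 2) ℂ, ∃ V ∈ unitaryGroup (Fin 2) ℂ,
      ∃ l, IsOptimalDecomposition (T * W) U V l := by
  obtain ⟨W, hW, l, hanti, hpos, h⟩ := exists_takagi_antitone transpose_transpose_mul_mul_self hT
  have hdiag : (T * W)ᵀ * (pauliY ⊗ₖ pauliY) * (T * W) = diagonal fun i => (l i : ℂ) := by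
    rw [← h, transpose_mul]
    simp only [Matrix.mul_assoc]
  obtain ⟨v, hv, hform⟩ := exists_neg_ptForm_mul_conjTranspose_eq hpos hdiag
  obtain ⟨U, hU, V, hV, hle⟩ :=
    exists_neg_ptForm_le_crossConcurrence (posSemidef_self_mul_conjTranspose (T * W)) hv
  refine ⟨W, hW, U, hU, V, hV, l, hdiag, hanti, fun i => (hpos i).le,
    neg_ptForm_mul_conjTranspose_le hanti hpos hdiag, ?_⟩
  rw [hform, mul_comm] at hle
  exact le_of_mul_le_mul_left hle (norm_pos_iff.2 hv)

theorem continuous_localConj {Z : Type*} [TopologicalSpace Z]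
    {P Q : Z → Matrix (Fin 2) (Fin 2) ℂ} {A : Z → Matrix Idx Idx ℂ} (hP : Continuous P)
    (hQ : Continuous Q) (hA : Continuous A) : Continuous fun z => localConj (P z) (Q z) (A z) := by
  have h : Continuous fun z => P z ⊗ₖ Q z :=
    continuous_matrix fun i j => (hP.matrix_elem i.1 j.1).mul (hQ.matrix_elem i.2 j.2)
  exact (h.matrix_mul hA).matrix_mul h.matrix_conjTranspose

theorem continuous_ptForm (v : Idx → ℂ) : Continuous fun A => ptForm A v := by
  have h : Continuous partialTranspose := continuous_matrix fun i j => by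
    simp only [partialTranspose, of_apply]
    fun_prop
  unfold ptForm
  fun_prop

theorem isClosed_setOf_isOptimalDecomposition {Z : Type*} [TopologicalSpace Z]
    {X : Z → Matrix Idx (Fin 4) ℂ} {U V : Z → Matrix (Fin 2) (Fin 2) ℂ} {l : Z → Fin 4 → ℝ}
    (hX : Continuous X) (hU : Continuous U) (hV : Continuous V) (hl : Continuous l) :
    IsClosed {z | IsOptimalDecomposition (X z) (U z) (V z) (l z)} := by
  have hXX : Continuous fun z => X z * (X z)ᴴ := hX.matrix_mul hX.matrix_conjTranspose
  have hset : {z | IsOptimalDecomposition (X z) (U z) (V z) (l z)} =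
      {z | (X z)ᵀ * (pauliY ⊗ₖ pauliY) * X z = diagonal (fun i => (l z i : ℂ)) ∧
        (∀ i j, i ≤ j → l z j ≤ l z i) ∧ (∀ i, 0 ≤ l z i) ∧
        (∀ v, -ptForm (X z * (X z)ᴴ) v ≤
          max 0 (l z 0 - l z 1 - l z 2 - l z 3) * ‖vecDet v‖) ∧
        l z 0 - l z 1 - l z 2 - l z 3 ≤
          crossConcurrence (localConj (U z) (V z) (X z * (X z)ᴴ))} := by
    ext z
    exact ⟨fun ⟨h₁, h₂, h₃, h₄, h₅⟩ => ⟨h₁, fun _ _ => (h₂ ·), h₃, h₄, h₅⟩,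
      fun ⟨h₁, h₂, h₃, h₄, h₅⟩ => ⟨h₁, fun _ _ => h₂ _ _, h₃, h₄, h₅⟩⟩
  simp only [hset, Set.ofPred_and, Set.ofPred_forall]
  refine .inter (isClosed_eq ?_ ?_) (.inter ?_ (.inter ?_ (.inter ?_ (isClosed_le ?_ ?_))))
  · exact (hX.matrix_transpose.matrix_mul continuous_const).matrix_mul hX
  · exact .matrix_diagonal (by fun_prop)
  · exact isClosed_iInter fun i => isClosed_iInter fun j => isClosed_iInter fun _ =>
      isClosed_le (by fun_prop) (by fun_prop)
  · exact isClosed_iInter fun i => isClosed_le continuous_const (by fun_prop)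
  · exact isClosed_iInter fun v =>
      isClosed_le ((continuous_ptForm v).comp hXX).neg (by fun_prop)
  · fun_prop
  · exact continuous_crossConcurrence.comp (continuous_localConj hU hV hXX)

instance compactSpace_unitaryGroup (n : Type*) [Fintype n] [DecidableEq n] :
    CompactSpace (unitaryGroup n ℂ) :=
  isCompact_iff_compactSpace.1 isCompact_unitaryGroup

theorem isClosed_setOf_exists_isOptimalDecomposition :
    IsClosed {T : Matrix Idx (Fin 4) ℂ | ∃ W ∈ unitaryGroup (Fin 4) ℂ,
      ∃ U ∈ unitaryGroup (Fin 2) ℂ, ∃ V ∈ unitaryGroup (Fin 2) ℂ,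
        ∃ l, IsOptimalDecomposition (T * W) U V l} := by
  let Z := Matrix Idx (Fin 4) ℂ ×
    unitaryGroup (Fin 4) ℂ × unitaryGroup (Fin 2) ℂ × unitaryGroup (Fin 2) ℂ
  let X (z : Z) : Matrix Idx (Fin 4) ℂ := z.1 * (z.2.1 : Matrix (Fin 4) (Fin 4) ℂ)
  -- the values are read off the diagonal, so that only the compact groups are projected away
  let l (z : Z) (i : Fin 4) : ℝ := (((X z)ᵀ * (pauliY ⊗ₖ pauliY) * X z) i i).re
  have hX : Continuous X := by fun_prop
  have hl : Continuous l := continuous_pi fun i => Complex.continuous_re.comp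
    (((hX.matrix_transpose.matrix_mul continuous_const).matrix_mul hX).matrix_elem i i)
  convert isClosedMap_fst_of_compactSpace _ (isClosed_setOf_isOptimalDecomposition hX
    (U := fun z : Z => (z.2.2.1 : Matrix (Fin 2) (Fin 2) ℂ))
    (V := fun z : Z => (z.2.2.2 : Matrix (Fin 2) (Fin 2) ℂ)) (by fun_prop) (by fun_prop) hl) using 1
  ext T
  constructor
  · rintro ⟨W, hW, U, hU, V, hV, m, h⟩
    refine ⟨(T, ⟨W, hW⟩, ⟨U, hU⟩, ⟨V, hV⟩), ?_, rfl⟩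
    have hm : l (T, ⟨W, hW⟩, ⟨U, hU⟩, ⟨V, hV⟩) = m := by
      ext i
      change (((T * W)ᵀ * (pauliY ⊗ₖ pauliY) * (T * W)) i i).re = m i
      rw [h.diagonal_eq, diagonal_apply_eq, Complex.ofReal_re]
    rwa [Set.mem_ofPred_eq, hm]
  · rintro ⟨⟨_, W, U, V⟩, h, rfl⟩
    exact ⟨W, W.2, U, U.2, V, V.2, _, h⟩

theorem pauliY_kronecker_mul_self : (pauliY ⊗ₖ pauliY) * (pauliY ⊗ₖ pauliY) = 1 := by
  have : pauliY * pauliY = 1 := by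
    ext i j; fin_cases i <;> fin_cases j <;> simp [pauliY]
  rw [← mul_kronecker_mul, this, one_kronecker_one]

theorem exists_isOptimalDecomposition {A : Matrix Idx Idx ℂ} (hA : A.PosSemidef) :
    ∃ X U V, U ∈ unitaryGroup (Fin 2) ℂ ∧ V ∈ unitaryGroup (Fin 2) ℂ ∧ A = X * Xᴴ ∧
      ∃ l, IsOptimalDecomposition X U V l := by
  obtain ⟨e⟩ : Nonempty (Fin 4 ≃ Idx) := ⟨Fintype.equivOfCardEq (by simp)⟩
  set S := CFC.sqrt A
  have hS : S.PosSemidef := nonneg_iff_posSemidef.1 (CFC.sqrt_nonneg A)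
  have hSS : S * Sᴴ = A := by rw [hS.isHermitian.eq, CFC.sqrt_mul_sqrt_self A hA.nonneg]
  let R : ℝ → Matrix Idx Idx ℂ := fun ε => S + (ε : ℂ) • 1
  have hunit {ε : ℝ} (hε : 0 < ε) :
      IsUnit (((R ε).submatrix id e)ᵀ * (pauliY ⊗ₖ pauliY) * (R ε).submatrix id e) := by
    have hR : IsUnit (R ε) :=
      (PosDef.posSemidef_add hS (PosDef.one.smul (Complex.zero_lt_real.2 hε))).isUnit
    have hY : IsUnit (pauliY ⊗ₖ pauliY) := .of_mul_eq_one _ pauliY_kronecker_mul_self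
    have hsub : ((R ε).submatrix id e)ᵀ * (pauliY ⊗ₖ pauliY) * (R ε).submatrix id e =
        ((R ε)ᵀ * (pauliY ⊗ₖ pauliY) * R ε).submatrix e e := rfl
    rw [hsub, isUnit_submatrix_equiv]
    exact (((isUnit_transpose _).2 hR).mul hY).mul hR
  have hR : Continuous fun ε => (R ε).submatrix id e := by fun_prop
  have hlim : Tendsto (fun ε => (R ε).submatrix id e) (𝓝[>] 0) (𝓝 ((R 0).submatrix id e)) :=
    (hR.tendsto 0).mono_left nhdsWithin_le_nhds
  obtain ⟨W, hW, U, hU, V, hV, l, h⟩ :=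
    isClosed_setOf_exists_isOptimalDecomposition.mem_of_tendsto hlim
      (eventually_mem_nhdsWithin.mono fun ε hε =>
        exists_isOptimalDecomposition_of_isUnit (hunit hε))
  refine ⟨_, U, V, hU, hV, ?_, l, h⟩
  have hR0 : R 0 = S := by simp [R]
  rw [conjTranspose_mul, Matrix.mul_assoc, ← Matrix.mul_assoc W,
    show W * Wᴴ = 1 from mem_unitaryGroup_iff.1 hW, Matrix.one_mul, hR0, conjTranspose_submatrix,
    submatrix_mul_equiv, hSS, submatrix_id_id]

theorem roots_charpoly_diagonal {n : Type*} [Fintype n] [DecidableEq n] (d : n → ℂ) :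
    (diagonal d).charpoly.roots = Finset.univ.val.map d := by
  rw [charpoly_diagonal, Polynomial.roots_prod]
  · simp
  · simp [Finset.prod_ne_zero_iff, Polynomial.X_sub_C_ne_zero]

theorem woottersValue_eq_of_roots (ρ : State) {l : Fin 4 → ℝ} (hanti : Antitone l)
    (hl : ∀ i, 0 ≤ l i)
    (hroots : (woottersMatrix ρ).charpoly.roots =
      Finset.univ.val.map fun i : Fin 4 => ((l i ^ 2 : ℝ) : ℂ)) :
    woottersValue ρ = l := by
  have hsq : Antitone fun i => l i ^ 2 := fun i j hij => pow_le_pow_left₀ (hl j) (hanti hij) 2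
  have hre : (woottersMatrix ρ).charpoly.roots.map RCLike.re =
      Finset.univ.val.map fun i : Fin 4 => l i ^ 2 := by
    rw [hroots, Multiset.map_map]
    exact Multiset.map_congr rfl fun i _ => Complex.ofReal_re _
  have hsort : ((woottersMatrix ρ).charpoly.roots.map RCLike.re).sort (· ≥ ·) =
      List.ofFn fun i => l i ^ 2 := by
    simp_rw [hre, Fin.univ_val_map, Multiset.coe_sort]
    apply List.mergeSort_of_pairwise
    simp_rw [decide_eq_true_eq, ← List.sortedGE_iff_pairwise]
    exact hsq.sortedGE_ofFn
  have heig := (woottersMatrix_isHermitian ρ).sort_roots_charpoly_eq_eigenvalues₀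
  rw [hsort] at heig
  ext k
  have hk : (woottersMatrix_isHermitian ρ).eigenvalues₀ (Fin.cast (by simp) k) = l k ^ 2 := by
    have h := congrArg (fun L : List ℝ => L[k.1]?) heig
    have hk' : k.1 < Fintype.card Idx := by simp
    simp only [List.getElem?_ofFn, k.2, hk', dif_pos, Option.some.injEq] at h
    exact h.symm
  rw [woottersValue, hk, Real.sqrt_sq (hl k)]

theorem charpoly_woottersMatrix {ρ : State} {X : Matrix Idx (Fin 4) ℂ} (hX : ρ.mat = X * Xᴴ) :
    (woottersMatrix ρ).charpoly =
      ((Xᵀ * (pauliY ⊗ₖ pauliY) * X)ᴴ * (Xᵀ * (pauliY ⊗ₖ pauliY) * X)).charpoly := by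
  have hstar : ρ.mat.map star = Xᵀᴴ * Xᵀ := by
    rw [hX]
    ext a b
    simp [Matrix.mul_apply]
  have hcomm := charpoly_mul_comm_of_le (spinFlip ρ.mat * X) Xᴴ (by simp)
  rw [Fintype.card_fin, show Fintype.card Idx = 4 by simp, Nat.sub_self, pow_zero, one_mul] at hcomm
  rw [woottersMatrix, Matrix.mul_assoc, charpoly_mul_comm, Matrix.mul_assoc,
    CFC.sqrt_mul_sqrt_self ρ.mat ρ.posSemidef.nonneg, hX, ← Matrix.mul_assoc, ← hX, hcomm, spinFlip,
    hstar]
  simp only [conjTranspose_mul, conjTranspose_kronecker, pauliY_conjTranspose, Matrix.mul_assoc]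

theorem woottersValue_eq {ρ : State} {X : Matrix Idx (Fin 4) ℂ} {U V : Matrix (Fin 2) (Fin 2) ℂ}
    {l : Fin 4 → ℝ} (hX : ρ.mat = X * Xᴴ) (h : IsOptimalDecomposition X U V l) :
    woottersValue ρ = l := by
  refine woottersValue_eq_of_roots ρ h.antitone h.nonneg ?_
  rw [charpoly_woottersMatrix hX, h.diagonal_eq, diagonal_conjTranspose, diagonal_mul_diagonal,
    roots_charpoly_diagonal]
  simp [sq]

end WoottersDecomposition

section Concurrence

theorem exists_phase_ptForm_antiVec {B : Matrix Idx Idx ℂ} (hB : B.IsHermitian) :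
    ∃ ω : ℂ, ‖ω‖ = 1 ∧ ∀ x y : ℝ, ptForm B (antiVec x (y * ω)) =
      x ^ 2 * (B (0, 1) (0, 1)).re + y ^ 2 * (B (1, 0) (1, 0)).re
        - 2 * (x * y) * ‖B (0, 0) (1, 1)‖ := by
  obtain ⟨ω, hω, h⟩ := Complex.exists_norm_eq_mul_self (B (0, 0) (1, 1))
  refine ⟨-ω, by rwa [norm_neg], fun x y => ?_⟩
  have hre : (star (x : ℂ) * (y * -ω) * B (0, 0) (1, 1)).re = -(x * y * ‖B (0, 0) (1, 1)‖) := by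
    rw [RCLike.star_def, Complex.conj_ofReal,
      show (x : ℂ) * (y * -ω) * B (0, 0) (1, 1) = -(x * y * (ω * B (0, 0) (1, 1))) by ring, ← h]
    norm_cast
  rw [ptForm_antiVec hB, hre, norm_mul, norm_neg, hω, mul_one, Complex.norm_real, Complex.norm_real,
    Real.norm_eq_abs, Real.norm_eq_abs, sq_abs, sq_abs]
  ring

theorem crossConcurrence_le {B : Matrix Idx Idx ℂ} (hB : B.PosSemidef) {c : ℝ}
    (h : ∀ v, -ptForm B v ≤ c * ‖vecDet v‖) : crossConcurrence B ≤ c := by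
  obtain ⟨ω, hω, hform⟩ := exists_phase_ptForm_antiVec hB.isHermitian
  have ha := re_diag_nonneg hB (0, 1)
  have hb := re_diag_nonneg hB (1, 0)
  set a := (B (0, 1) (0, 1)).re
  set b := (B (1, 0) (1, 0)).re
  set r := ‖B (0, 0) (1, 1)‖
  rw [crossConcurrence]
  rcases le_total (2 * r - c) 0 with h0 | h0
  · linarith [Real.sqrt_nonneg (a * b)]
  · have hquad (x : ℝ) : 0 ≤ a * (x * x) + -(2 * r - c) * x + b := by
      have hx := h (antiVec x ((1 : ℝ) * ω))
      rw [hform, vecDet_antiVec, norm_neg, norm_mul, norm_mul, hω, Complex.norm_real,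
        Complex.norm_real, norm_one, Real.norm_eq_abs] at hx
      rcases le_total 0 x with h1 | h1
      · rw [abs_of_nonneg h1] at hx
        linarith
      · nlinarith [mul_nonneg ha (sq_nonneg x), mul_nonneg h0 (neg_nonneg.2 h1)]
    have hdiscrim := discrim_le_zero hquad
    rw [discrim] at hdiscrim
    have : (2 * r - c) / 2 ≤ √(a * b) := Real.le_sqrt_of_sq_le (by linarith)
    linarith

theorem neg_ptForm_le_concurrence (ρ : State) (v : Idx → ℂ) :
    -ptForm ρ.mat v ≤ concurrence ρ * ‖vecDet v‖ := by
  obtain ⟨X, U, V, -, -, hX, l, h⟩ := exists_isOptimalDecomposition ρ.posSemidef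
  rw [concurrence, woottersValue_eq hX h, hX]
  exact h.neg_ptForm_le v

theorem exists_localUnitaryEquiv_concurrence_eq (ρ : State) :
    ∃ σ : State, LocalUnitaryEquiv ρ.mat σ.mat ∧
      concurrence ρ = max 0 (crossConcurrence σ.mat) := by
  obtain ⟨X, U, V, hU, hV, hX, l, h⟩ := exists_isOptimalDecomposition ρ.posSemidef
  have heq := localUnitaryEquiv_localConj hU hV ρ.mat
  have hB := posSemidef_localConj ρ.posSemidef U V
  refine ⟨⟨localConj U V ρ.mat, hB, (trace_localConj hU hV _).trans ρ.trace_eq_one⟩, heq.symm,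
    le_antisymm ?_ (max_le (le_max_left _ _) (crossConcurrence_le hB fun v => ?_))⟩
  · have hle := h.le_crossConcurrence
    rw [← hX] at hle
    rw [concurrence, woottersValue_eq hX h]
    exact max_le_max le_rfl hle
  · obtain ⟨w, hform, -, hdet⟩ := heq.exists_ptForm_eq v
    rw [hform, ← hdet]
    exact neg_ptForm_le_concurrence ρ w

theorem concurrence_le_iff (ρ : State) {c : ℝ} (hc : 0 ≤ c) :
    concurrence ρ ≤ c ↔ ∀ v, -ptForm ρ.mat v ≤ c * ‖vecDet v‖ := by
  refine ⟨fun h v => (neg_ptForm_le_concurrence ρ v).trans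
    (mul_le_mul_of_nonneg_right h (norm_nonneg _)), fun h => ?_⟩
  obtain ⟨σ, heq, hσ⟩ := exists_localUnitaryEquiv_concurrence_eq ρ
  rw [hσ]
  refine max_le hc (crossConcurrence_le σ.posSemidef fun v => ?_)
  obtain ⟨w, hform, -, hdet⟩ := heq.symm.exists_ptForm_eq v
  rw [hform, ← hdet]
  exact h w

theorem concurrence_nonneg (ρ : State) : 0 ≤ concurrence ρ := le_max_left _ _

end Concurrence

section Eigenvectors

theorem star_dotProduct_mulVec_of_eigenvector {n : Type*} [Fintype n] {M : Matrix n n ℂ}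
    (hM : M.IsHermitian) {μ : ℝ} {v : n → ℂ} (hv : M *ᵥ v = (μ : ℂ) • v) (w : n → ℂ) :
    star v ⬝ᵥ M *ᵥ w = μ * (star v ⬝ᵥ w) := by
  have h : star v ᵥ* M = (μ : ℂ) • star v := by
    have := congrArg star hv
    rw [star_mulVec, hM.eq, star_smul] at this
    simpa using this
  rw [dotProduct_mulVec, h, smul_dotProduct, smul_eq_mul]

theorem ptForm_of_eigenvector {A : Matrix Idx Idx ℂ} {μ : ℝ} {v : Idx → ℂ}
    (hv : partialTranspose A *ᵥ v = (μ : ℂ) • v) : ptForm A v = μ * vecNormSq v := by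
  rw [ptForm, hv, dotProduct_smul, star_dotProduct_self, smul_eq_mul, ← Complex.ofReal_mul,
    Complex.ofReal_re]

theorem ptForm_add_of_eigenvector {A : Matrix Idx Idx ℂ} (hA : A.IsHermitian) {μ : ℝ}
    {v w : Idx → ℂ} (hv : partialTranspose A *ᵥ v = (μ : ℂ) • v) (hvw : star v ⬝ᵥ w = 0) :
    ptForm A (v + w) = ptForm A v + ptForm A w := by
  have hwv : star w ⬝ᵥ v = 0 := by rw [star_dotProduct, hvw, star_zero]
  have hcross := star_dotProduct_mulVec_of_eigenvector (partialTranspose_isHermitian hA) hv w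
  simp only [ptForm, star_add, mulVec_add, add_dotProduct, dotProduct_add, hcross, hv, hvw,
    dotProduct_smul, hwv, mul_zero, add_zero, zero_add, Complex.add_re]

theorem exists_vecDet_eq_zero (v w : Idx → ℂ) :
    ∃ α β : ℂ, (α ≠ 0 ∨ β ≠ 0) ∧ vecDet (α • v + β • w) = 0 := by
  by_cases hv : vecDet v = 0
  · exact ⟨1, 0, .inl one_ne_zero, by simpa using hv⟩
  · obtain ⟨s, hs⟩ := IsAlgClosed.exists_pow_nat_eq
      (discrim (vecDet v) (polarDet (coeffMatrix v) (coeffMatrix w)) (vecDet w)) two_pos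
    obtain ⟨x, hx⟩ := exists_quadratic_eq_zero hv ⟨s, by rw [← hs, sq]⟩
    refine ⟨x, 1, .inr one_ne_zero, ?_⟩
    rw [one_smul, vecDet_add, vecDet_smul, ← hx]
    simp only [polarDet, coeffMatrix, of_apply, Pi.smul_apply, smul_eq_mul]
    ring

theorem ptForm_nonneg_of_vecDet_eq_zero {A : Matrix Idx Idx ℂ} (hA : A.PosSemidef) {v : Idx → ℂ}
    (hv : vecDet v = 0) : 0 ≤ ptForm A v := by
  obtain ⟨X, U, V, -, -, rfl, l, h⟩ := exists_isOptimalDecomposition hA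
  simpa [hv] using h.neg_ptForm_le v

theorem eq_zero_of_orthogonal_negative_eigenvectors {A : Matrix Idx Idx ℂ} (hA : A.PosSemidef)
    {μ ν : ℝ} {v w : Idx → ℂ} (hμ : μ < 0) (hν : ν < 0)
    (hv : partialTranspose A *ᵥ v = (μ : ℂ) • v) (hw : partialTranspose A *ᵥ w = (ν : ℂ) • w)
    (hvw : star v ⬝ᵥ w = 0) : v = 0 ∨ w = 0 := by
  by_contra! hne
  obtain ⟨α, β, hαβ, hdet⟩ := exists_vecDet_eq_zero v w
  have hsum := ptForm_nonneg_of_vecDet_eq_zero hA hdet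
  rw [ptForm_add_of_eigenvector hA.isHermitian (μ := μ)
    (by rw [mulVec_smul, hv, smul_comm]) (by simp [hvw]), ptForm_vec_smul, ptForm_vec_smul,
    ptForm_of_eigenvector hv, ptForm_of_eigenvector hw] at hsum
  have hv' : μ * vecNormSq v < 0 := mul_neg_of_neg_of_pos hμ (vecNormSq_pos hne.1)
  have hw' : ν * vecNormSq w < 0 := mul_neg_of_neg_of_pos hν (vecNormSq_pos hne.2)
  rcases hαβ with h | h
  · nlinarith [pow_pos (norm_pos_iff.2 h) 2, sq_nonneg ‖β‖]
  · nlinarith [pow_pos (norm_pos_iff.2 h) 2, sq_nonneg ‖α‖]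

theorem negative_eigenvector_unique {A : Matrix Idx Idx ℂ} (hA : A.PosSemidef) {μ ν : ℝ}
    {v w : Idx → ℂ} (hμ : μ < 0) (hν : ν < 0) (hv1 : star v ⬝ᵥ v = 1) (hw0 : w ≠ 0)
    (hv : partialTranspose A *ᵥ v = (μ : ℂ) • v) (hw : partialTranspose A *ᵥ w = (ν : ℂ) • w) :
    ν = μ ∧ ∃ c : ℂ, w = c • v := by
  set c := star v ⬝ᵥ w
  have hc : (ν : ℂ) * c = μ * c := by
    rw [← star_dotProduct_mulVec_of_eigenvector (partialTranspose_isHermitian hA.isHermitian) hv w,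
      hw, dotProduct_smul, smul_eq_mul]
  have horth : star v ⬝ᵥ (w - c • v) = 0 := by
    rw [dotProduct_sub, dotProduct_smul, hv1, smul_eq_mul, mul_one, sub_self]
  have heig : partialTranspose A *ᵥ (w - c • v) = (ν : ℂ) • (w - c • v) := by
    rw [mulVec_sub, mulVec_smul, hw, hv, smul_sub, smul_smul, smul_smul, hc, mul_comm c]
  have hv0 : v ≠ 0 := fun h => by simp [h] at hv1
  have hwc : w = c • v := sub_eq_zero.1
    ((eq_zero_of_orthogonal_negative_eigenvectors hA hμ hν hv heig horth).resolve_left hv0)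
  have hc0 : c ≠ 0 := fun h => hw0 (by rw [hwc, h, zero_smul])
  exact ⟨Complex.ofReal_injective (mul_right_cancel₀ hc0 hc), c, hwc⟩

end Eigenvectors

section Negativity

theorem negativity_nonneg (ρ : State) : 0 ≤ negativity ρ :=
  mul_nonneg zero_le_two (Finset.sum_nonneg fun _ _ => le_max_left _ _)

theorem algebraMap_neg_negativity_le (ρ : State) :
    algebraMap ℝ (Matrix Idx Idx ℂ) (-(negativity ρ / 2)) ≤ partialTranspose ρ.mat := by
  have hH := ρ.isHermitian_partialTranspose
  refine algebraMap_le_of_le_spectrum (fun x hx => ?_) hH.isSelfAdjoint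
  obtain ⟨i, rfl⟩ := hH.spectrum_real_eq_range_eigenvalues ▸ hx
  have hi := Finset.single_le_sum (f := fun j => max 0 (-hH.eigenvalues j))
    (fun _ _ => le_max_left _ _) (Finset.mem_univ i)
  rw [negativity]
  linarith [le_max_right 0 (-hH.eigenvalues i)]

theorem star_dotProduct_sub_algebraMap_mulVec_re (A : Matrix Idx Idx ℂ) (c : ℝ) (v : Idx → ℂ) :
    (star v ⬝ᵥ (partialTranspose A - algebraMap ℝ _ c) *ᵥ v).re = ptForm A v - c * vecNormSq v := by
  rw [sub_mulVec, Algebra.algebraMap_eq_smul_one, smul_mulVec, one_mulVec, dotProduct_sub,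
    dotProduct_smul, star_dotProduct_self, Complex.sub_re, Complex.real_smul,
    Complex.re_ofReal_mul, Complex.ofReal_re, ptForm]

theorem neg_ptForm_le_negativity (ρ : State) (v : Idx → ℂ) :
    -ptForm ρ.mat v ≤ negativity ρ / 2 * vecNormSq v := by
  have h := (Complex.le_def.1
    ((le_iff.1 (algebraMap_neg_negativity_le ρ)).dotProduct_mulVec_nonneg v)).1
  rw [star_dotProduct_sub_algebraMap_mulVec_re, Complex.zero_re] at h
  linarith

theorem partialTranspose_mulVec_of_ptForm_eq (ρ : State) {v : Idx → ℂ}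
    (hv : ptForm ρ.mat v = -(negativity ρ / 2) * vecNormSq v) :
    partialTranspose ρ.mat *ᵥ v = ((-(negativity ρ / 2) : ℝ) : ℂ) • v := by
  have hpos := le_iff.1 (algebraMap_neg_negativity_le ρ)
  have hzero : star v ⬝ᵥ (partialTranspose ρ.mat - algebraMap ℝ _ (-(negativity ρ / 2))) *ᵥ v = 0 :=
    Complex.ext (by rw [star_dotProduct_sub_algebraMap_mulVec_re, hv, sub_self, Complex.zero_re])
      (Complex.le_def.1 (hpos.dotProduct_mulVec_nonneg v)).2.symm
  have hker := (hpos.dotProduct_mulVec_zero_iff v).1 hzero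
  rw [sub_mulVec, Algebra.algebraMap_eq_smul_one, smul_mulVec, one_mulVec, sub_eq_zero] at hker
  exact hker

theorem exists_negative_eigenvector (ρ : State) (hN : 0 < negativity ρ) :
    ∃ (μ : ℝ) (v : Idx → ℂ), μ < 0 ∧ star v ⬝ᵥ v = 1 ∧
      partialTranspose ρ.mat *ᵥ v = (μ : ℂ) • v ∧ negativity ρ = 2 * |μ| := by
  set hH := ρ.isHermitian_partialTranspose
  have hdef : negativity ρ = 2 * ∑ j, max 0 (-hH.eigenvalues j) := rfl
  obtain ⟨i, hi⟩ : ∃ i, hH.eigenvalues i < 0 := by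
    by_contra! h
    rw [hdef, Finset.sum_eq_zero fun j _ => max_eq_left (neg_nonpos.2 (h j))] at hN
    simp at hN
  let e (j : Idx) : Idx → ℂ := (hH.eigenvectorBasis j).ofLp
  have heig (j : Idx) : partialTranspose ρ.mat *ᵥ e j = (hH.eigenvalues j : ℂ) • e j :=
    hH.mulVec_eigenvectorBasis j
  have horth (j k : Idx) : star (e j) ⬝ᵥ e k = if j = k then 1 else 0 := by
    rw [← orthonormal_iff_ite.1 hH.eigenvectorBasis.orthonormal j k,
      EuclideanSpace.inner_eq_star_dotProduct, dotProduct_comm]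
  have hne (j : Idx) : e j ≠ 0 := fun h => by simpa [h] using horth j j
  have hother (j : Idx) (hji : j ≠ i) : max 0 (-hH.eigenvalues j) = 0 := by
    refine max_eq_left (neg_nonpos.2 (not_lt.1 fun hj => ?_))
    have hij : star (e i) ⬝ᵥ e j = 0 := by rw [horth, if_neg hji.symm]
    exact (eq_zero_of_orthogonal_negative_eigenvectors ρ.posSemidef hi hj (heig i) (heig j)
      hij).elim (hne i) (hne j)
  refine ⟨hH.eigenvalues i, e i, hi, by rw [horth, if_pos rfl], heig i, ?_⟩
  rw [hdef, abs_of_neg hi, Fintype.sum_eq_single i hother, max_eq_right (neg_nonneg.2 hi.le)]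

theorem negativity_le_iff (ρ : State) {c : ℝ} (hc : 0 ≤ c) :
    negativity ρ ≤ c ↔ ∀ v, -ptForm ρ.mat v ≤ c / 2 * vecNormSq v := by
  refine ⟨fun h v => (neg_ptForm_le_negativity ρ v).trans (mul_le_mul_of_nonneg_right (by linarith)
    (Finset.sum_nonneg fun _ _ => sq_nonneg _)), fun h => ?_⟩
  rcases (negativity_nonneg ρ).eq_or_lt with h0 | h0
  · rwa [← h0]
  · obtain ⟨μ, v, hμ, hv1, hv, hN⟩ := exists_negative_eigenvector ρ h0
    have hnorm : vecNormSq v = 1 := by exact_mod_cast (star_dotProduct_self v).symm.trans hv1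
    have hform := h v
    rw [ptForm_of_eigenvector hv, hnorm] at hform
    rw [hN, abs_of_neg hμ]
    linarith

theorem LocalUnitaryEquiv.negativity_eq {ρ σ : State} (h : LocalUnitaryEquiv ρ.mat σ.mat) :
    negativity ρ = negativity σ := by
  have hle {ρ σ : State} (h : LocalUnitaryEquiv ρ.mat σ.mat) : negativity ρ ≤ negativity σ := by
    refine (negativity_le_iff ρ (negativity_nonneg σ)).2 fun v => ?_
    obtain ⟨w, hform, hnorm, -⟩ := h.exists_ptForm_eq v
    rw [hform, ← hnorm]
    exact neg_ptForm_le_negativity σ w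
  exact le_antisymm (hle h) (hle h.symm)

theorem negativity_le_concurrence (ρ : State) : negativity ρ ≤ concurrence ρ := by
  refine (negativity_le_iff ρ (concurrence_nonneg ρ)).2 fun v => ?_
  calc -ptForm ρ.mat v ≤ concurrence ρ * ‖vecDet v‖ := neg_ptForm_le_concurrence ρ v
    _ ≤ concurrence ρ * (vecNormSq v / 2) :=
        mul_le_mul_of_nonneg_left (norm_vecDet_le v) (concurrence_nonneg ρ)
    _ = concurrence ρ / 2 * vecNormSq v := by ring

end Negativity

section LowerBound

theorem two_mul_norm_le_re_add_re {B : Matrix Idx Idx ℂ} (hB : B.PosSemidef) (i j : Idx) :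
    2 * ‖B i j‖ ≤ (B i i).re + (B j j).re := by
  have hi := re_diag_nonneg hB i
  have hj := re_diag_nonneg hB j
  refine (sq_le_sq₀ (by positivity) (add_nonneg hi hj)).1 ?_
  nlinarith [sq_norm_le_mul_re hB i j, sq_nonneg ((B i i).re - (B j j).re)]

theorem apply_eq_zero_of_re_eq_zero {B : Matrix Idx Idx ℂ} (hB : B.PosSemidef) {i : Idx}
    (hi : (B i i).re = 0) (j : Idx) : B i j = 0 ∧ B j i = 0 := by
  have hij := sq_norm_le_mul_re hB i j
  have hji := sq_norm_le_mul_re hB j i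
  rw [hi, zero_mul] at hij
  rw [hi, mul_zero] at hji
  exact ⟨norm_eq_zero.1 (pow_eq_zero_iff two_ne_zero |>.1 (le_antisymm hij (sq_nonneg _))),
    norm_eq_zero.1 (pow_eq_zero_iff two_ne_zero |>.1 (le_antisymm hji (sq_nonneg _)))⟩

theorem re_diag_add_eq_one (ρ : State) :
    (ρ.mat (0, 0) (0, 0)).re + (ρ.mat (0, 1) (0, 1)).re +
      (ρ.mat (1, 0) (1, 0)).re + (ρ.mat (1, 1) (1, 1)).re = 1 := by
  have h := congrArg Complex.re ρ.trace_eq_one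
  simp only [trace, diag_apply, Fintype.sum_prod_type, Fin.sum_univ_two, Complex.add_re,
    Complex.one_re] at h
  linarith

theorem crossConcurrence_le_one_sub (ρ : State) :
    crossConcurrence ρ.mat ≤ 1 - ((ρ.mat (0, 1) (0, 1)).re + (ρ.mat (1, 0) (1, 0)).re +
      2 * √((ρ.mat (0, 1) (0, 1)).re * (ρ.mat (1, 0) (1, 0)).re)) := by
  rw [crossConcurrence]
  linarith [two_mul_norm_le_re_add_re ρ.posSemidef (0, 0) (1, 1), re_diag_add_eq_one ρ]

theorem four_mul_sq_norm_le (ρ : State) :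
    4 * ‖ρ.mat (0, 0) (1, 1)‖ ^ 2 ≤
      (negativity ρ + 2 * (ρ.mat (0, 1) (0, 1)).re) *
        (negativity ρ + 2 * (ρ.mat (1, 0) (1, 0)).re) := by
  obtain ⟨ω, hω, hform⟩ := exists_phase_ptForm_antiVec ρ.posSemidef.isHermitian
  have hquad (x : ℝ) : 0 ≤ (negativity ρ + 2 * (ρ.mat (0, 1) (0, 1)).re) * (x * x) +
      -(4 * ‖ρ.mat (0, 0) (1, 1)‖) * x + (negativity ρ + 2 * (ρ.mat (1, 0) (1, 0)).re) := by
    have hx := neg_ptForm_le_negativity ρ (antiVec x ((1 : ℝ) * ω))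
    rw [hform, vecNormSq_antiVec, norm_mul, hω, Complex.norm_real, Complex.norm_real,
      norm_one, Real.norm_eq_abs, sq_abs] at hx
    linarith
  have hdiscrim := discrim_le_zero hquad
  rw [discrim] at hdiscrim
  linarith

theorem sq_crossConcurrence_add_le (ρ : State) :
    crossConcurrence ρ.mat ^ 2 + 4 * (crossConcurrence ρ.mat + negativity ρ) *
        √((ρ.mat (0, 1) (0, 1)).re * (ρ.mat (1, 0) (1, 0)).re) ≤
      negativity ρ ^ 2 + 2 * negativity ρ * (1 - crossConcurrence ρ.mat) := by
  have hnorm := four_mul_sq_norm_le ρ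
  have hle := mul_le_mul_of_nonneg_left (crossConcurrence_le_one_sub ρ) (negativity_nonneg ρ)
  have hsqrt := Real.sq_sqrt (mul_nonneg (re_diag_nonneg ρ.posSemidef (0, 1))
    (re_diag_nonneg ρ.posSemidef (1, 0)))
  have hdef : ‖ρ.mat (0, 0) (1, 1)‖ = crossConcurrence ρ.mat / 2 +
      √((ρ.mat (0, 1) (0, 1)).re * (ρ.mat (1, 0) (1, 0)).re) := by
    rw [crossConcurrence]
    ring
  rw [hdef] at hnorm
  linarith

theorem exists_localUnitaryEquiv_crossConcurrence_eq (ρ : State) (hC : 0 < concurrence ρ) :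
    ∃ σ : State, LocalUnitaryEquiv ρ.mat σ.mat ∧ concurrence ρ = crossConcurrence σ.mat := by
  obtain ⟨σ, heq, hσ⟩ := exists_localUnitaryEquiv_concurrence_eq ρ
  refine ⟨σ, heq, hσ.trans (max_eq_right_iff.2 ?_)⟩
  by_contra! h
  rw [hσ, max_eq_left h.le] at hC
  exact hC.false

theorem concurrence_le_one (ρ : State) : concurrence ρ ≤ 1 := by
  rcases (concurrence_nonneg ρ).eq_or_lt with h | h
  · exact h ▸ zero_le_one
  · obtain ⟨σ, -, hσ⟩ := exists_localUnitaryEquiv_crossConcurrence_eq ρ h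
    linarith [crossConcurrence_le_one_sub σ, re_diag_nonneg σ.posSemidef (0, 1),
      re_diag_nonneg σ.posSemidef (1, 0),
      Real.sqrt_nonneg ((σ.mat (0, 1) (0, 1)).re * (σ.mat (1, 0) (1, 0)).re)]

theorem sq_concurrence_le (ρ : State) :
    concurrence ρ ^ 2 ≤ negativity ρ ^ 2 + 2 * negativity ρ * (1 - concurrence ρ) := by
  rcases (concurrence_nonneg ρ).eq_or_lt with h | h
  · rw [← h]
    nlinarith [negativity_nonneg ρ]
  · obtain ⟨σ, heq, hσ⟩ := exists_localUnitaryEquiv_crossConcurrence_eq ρ h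
    have hle := sq_crossConcurrence_add_le σ
    rw [← hσ, ← heq.negativity_eq] at hle
    refine le_trans (le_add_of_nonneg_right ?_) hle
    have := negativity_nonneg ρ
    positivity

theorem negativity_pos (ρ : State) (hC : 0 < concurrence ρ) : 0 < negativity ρ := by
  refine (negativity_nonneg ρ).lt_of_ne fun h => ?_
  have hle := sq_concurrence_le ρ
  rw [← h] at hle
  nlinarith

theorem sqrt_sub_le_negativity (ρ : State) :
    √((1 - concurrence ρ) ^ 2 + concurrence ρ ^ 2) - (1 - concurrence ρ) ≤ negativity ρ := by
  have := concurrence_le_one ρ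
  rw [sub_le_iff_le_add, Real.sqrt_le_left (by linarith [negativity_nonneg ρ])]
  linarith [sq_concurrence_le ρ]

theorem sq_add_two_mul_mul_eq_sq {N C : ℝ} (h : N = √((1 - C) ^ 2 + C ^ 2) - (1 - C)) :
    N ^ 2 + 2 * N * (1 - C) = C ^ 2 := by
  have hsq := Real.sq_sqrt (show 0 ≤ (1 - C) ^ 2 + C ^ 2 by positivity)
  rw [show √((1 - C) ^ 2 + C ^ 2) = N + (1 - C) by linarith] at hsq
  linarith

end LowerBound

section QuasiDistillable

theorem quasiDistillable_apply (c : ℝ) (a b : Idx) :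
    quasiDistillable c a b =
      (c / 2 : ℂ) * ((ket 0 0 + ket 1 1) a * star ((ket 0 0 + ket 1 1) b)) +
        (1 - c : ℂ) * (ket 0 1 a * star (ket 0 1 b)) := by
  have hbell : bell 0 = ((√2 : ℝ) : ℂ)⁻¹ • (ket 0 0 + ket 1 1) := rfl
  have hsq : ‖((√2 : ℝ) : ℂ)⁻¹‖ ^ 2 = 1 / 2 := by
    rw [norm_inv, Complex.norm_real, inv_pow, Real.norm_eq_abs, sq_abs, Real.sq_sqrt zero_le_two,
      one_div]
  rw [quasiDistillable, hbell, proj_smul, hsq]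
  simp only [Matrix.add_apply, Matrix.smul_apply, proj, vecMulVec_apply, Pi.star_apply, smul_eq_mul]
  push_cast
  ring

theorem ptForm_quasiDistillable (c : ℝ) (w : Idx → ℂ) :
    ptForm (quasiDistillable c) w = c / 2 * (‖w (0, 0)‖ ^ 2 + ‖w (1, 1)‖ ^ 2)
      + (1 - c) * ‖w (0, 1)‖ ^ 2 + c * (star (w (0, 1)) * w (1, 0)).re := by
  have hnorm (z : ℂ) : z * star z = ((‖z‖ ^ 2 : ℝ) : ℂ) := by simpa using Complex.mul_conj' z
  have hform : star w ⬝ᵥ partialTranspose (quasiDistillable c) *ᵥ w =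
      ((c / 2 : ℝ) : ℂ) * (w (0, 0) * star (w (0, 0)) + w (1, 1) * star (w (1, 1)))
      + ((1 - c : ℝ) : ℂ) * (w (0, 1) * star (w (0, 1)))
      + ((c / 2 : ℝ) : ℂ) * (star (w (0, 1)) * w (1, 0) + star (star (w (0, 1)) * w (1, 0))) := by
    simp [partialTranspose, quasiDistillable_apply, mulVec, dotProduct, Fintype.sum_prod_type,
      Fin.sum_univ_two, ket, Pi.single_apply]
    ring
  rw [ptForm, hform, hnorm, hnorm, hnorm]
  simp only [Complex.add_re, Complex.re_ofReal_mul, Complex.ofReal_re, RCLike.star_def,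
    Complex.conj_re]
  ring

theorem neg_ptForm_quasiDistillable_le {c : ℝ} (h0 : 0 ≤ c) (w : Idx → ℂ) :
    -ptForm (quasiDistillable c) w ≤ c * (‖w (0, 1)‖ * ‖w (1, 0)‖) -
      c / 2 * (‖w (0, 0)‖ ^ 2 + ‖w (1, 1)‖ ^ 2) - (1 - c) * ‖w (0, 1)‖ ^ 2 := by
  have hre : -(star (w (0, 1)) * w (1, 0)).re ≤ ‖w (0, 1)‖ * ‖w (1, 0)‖ := by
    have := (neg_le_abs _).trans (Complex.abs_re_le_norm (star (w (0, 1)) * w (1, 0)))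
    rwa [norm_mul, norm_star] at this
  rw [ptForm_quasiDistillable]
  linarith [mul_le_mul_of_nonneg_left hre h0]

theorem neg_ptForm_quasiDistillable_le_mul_norm_vecDet {c : ℝ} (h0 : 0 ≤ c) (h1 : c ≤ 1)
    (w : Idx → ℂ) : -ptForm (quasiDistillable c) w ≤ c * ‖vecDet w‖ := by
  have hdet : ‖w (0, 1)‖ * ‖w (1, 0)‖ - ‖w (0, 0)‖ * ‖w (1, 1)‖ ≤ ‖vecDet w‖ := by
    rw [vecDet, ← norm_mul, ← norm_mul, norm_sub_rev]
    exact norm_sub_norm_le _ _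
  have hamgm : ‖w (0, 1)‖ * ‖w (1, 0)‖ - (‖w (0, 0)‖ ^ 2 + ‖w (1, 1)‖ ^ 2) / 2 ≤ ‖vecDet w‖ := by
    linarith [two_mul_le_add_sq ‖w (0, 0)‖ ‖w (1, 1)‖]
  linarith [neg_ptForm_quasiDistillable_le h0 w, mul_le_mul_of_nonneg_left hamgm h0,
    mul_nonneg (sub_nonneg.2 h1) (sq_nonneg ‖w (0, 1)‖)]

theorem concurrence_of_quasiDistillable (ρ : State) {c : ℝ} (h0 : 0 ≤ c) (h1 : c ≤ 1)
    (h : LocalUnitaryEquiv ρ.mat (quasiDistillable c)) : concurrence ρ = c := by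
  refine le_antisymm ((concurrence_le_iff ρ h0).2 fun v => ?_) (not_lt.1 fun hlt => ?_)
  · obtain ⟨w, hform, -, hdet⟩ := h.exists_ptForm_eq v
    rw [hform, ← hdet]
    exact neg_ptForm_quasiDistillable_le_mul_norm_vecDet h0 h1 w
  · set x := (c - concurrence ρ) / 2 with hx_def
    have hx : 0 < x := by linarith
    obtain ⟨w, hform, -, hdet⟩ := h.symm.exists_ptForm_eq (antiVec x (-1))
    have hw := neg_ptForm_le_concurrence ρ w
    rw [← hform, hdet, ptForm_quasiDistillable, vecDet_antiVec] at hw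
    simp only [antiVec, ofCoeff, of_apply, cons_val', cons_val_zero, cons_val_one,
      cons_val_fin_one, norm_zero, RCLike.star_def, Complex.conj_ofReal, mul_neg, mul_one,
      Complex.neg_re, Complex.ofReal_re, Complex.norm_real, neg_neg,
      Real.norm_of_nonneg hx.le] at hw
    nlinarith [mul_nonneg h0 (mul_pos hx hx).le, mul_pos hx hx]

theorem neg_ptForm_quasiDistillable_le_mul_vecNormSq {N c : ℝ} (hN : 0 < N) (h0 : 0 ≤ c)
    (h : N ^ 2 + 2 * N * (1 - c) = c ^ 2) (w : Idx → ℂ) :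
    -ptForm (quasiDistillable c) w ≤ N / 2 * vecNormSq w := by
  set x := ‖w (0, 1)‖
  set y := ‖w (1, 0)‖
  have hquad : 0 ≤ (1 - c + N / 2) * x ^ 2 - c * (x * y) + N / 2 * y ^ 2 := by
    refine nonneg_of_mul_nonneg_right (a := 2 * N) ?_ (by positivity)
    have hsq : 2 * N * ((1 - c + N / 2) * x ^ 2 - c * (x * y) + N / 2 * y ^ 2) =
        (c * x - N * y) ^ 2 := by linear_combination x ^ 2 * h
    rw [hsq]
    positivity
  have houter : 0 ≤ (c / 2 + N / 2) * (‖w (0, 0)‖ ^ 2 + ‖w (1, 1)‖ ^ 2) := by positivity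
  rw [vecNormSq_eq]
  linarith [neg_ptForm_quasiDistillable_le h0 w]

theorem negativity_of_quasiDistillable (ρ : State) (hC : 0 < concurrence ρ)
    (h : LocalUnitaryEquiv ρ.mat (quasiDistillable (concurrence ρ))) :
    negativity ρ = √((1 - concurrence ρ) ^ 2 + concurrence ρ ^ 2) - (1 - concurrence ρ) := by
  set N := √((1 - concurrence ρ) ^ 2 + concurrence ρ ^ 2) - (1 - concurrence ρ) with hN_def
  have hN : 0 < N := sub_pos.2 (Real.lt_sqrt_of_sq_lt (by nlinarith))
  refine le_antisymm ((negativity_le_iff ρ hN.le).2 fun v => ?_) (sqrt_sub_le_negativity ρ)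
  obtain ⟨w, hform, hnorm, -⟩ := h.exists_ptForm_eq v
  rw [hform, ← hnorm]
  exact neg_ptForm_quasiDistillable_le_mul_vecNormSq hN hC.le (sq_add_two_mul_mul_eq_sq hN_def) w

theorem rank_quasiDistillable_le (c : ℝ) : (quasiDistillable c).rank ≤ 2 := by
  let F : Matrix Idx (Fin 2) ℂ :=
    of fun a => ![(c : ℂ) * bell 0 a, ((1 - c : ℝ) : ℂ) * ket 0 1 a]
  let G : Matrix (Fin 2) Idx ℂ := of ![star (bell 0), star (ket 0 1)]
  have hFG : quasiDistillable c = F * G := by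
    ext a b
    simp [F, G, Matrix.mul_apply, Fin.sum_univ_two, quasiDistillable, proj, vecMulVec_apply,
      mul_assoc]
  rw [hFG]
  exact (rank_mul_le_left F G).trans ((rank_le_card_width F).trans_eq (Fintype.card_fin 2))

theorem rank_quasiDistillable {c : ℝ} (h0 : 0 < c) (h1 : c < 1) :
    (quasiDistillable c).rank = 2 := by
  refine le_antisymm (rank_quasiDistillable_le c) ?_
  let f : Fin 2 → Idx := ![(0, 0), (0, 1)]
  have hsub : (quasiDistillable c).submatrix f f = diagonal ![(c / 2 : ℂ), 1 - c] := by
    ext i j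
    fin_cases i <;> fin_cases j <;> simp [f, quasiDistillable_apply, ket]
  have hdet : ((quasiDistillable c).submatrix f f).det ≠ 0 := by
    have hc0 : (c : ℂ) ≠ 0 := by exact_mod_cast h0.ne'
    have hc1 : (1 - c : ℂ) ≠ 0 := by exact_mod_cast (sub_pos.2 h1).ne'
    simp [hsub, hc0, hc1]
  have hrank := rank_of_isUnit _ ((isUnit_iff_isUnit_det _).2 hdet.isUnit)
  rw [Fintype.card_fin] at hrank
  exact hrank.symm.trans_le (rank_submatrix_le _ _ _)

end QuasiDistillable

section LowerBoundEquality

theorem re_eq_of_sq_crossConcurrence_eq (ρ : State) (hX : 0 < crossConcurrence ρ.mat)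
    (heq : negativity ρ ^ 2 + 2 * negativity ρ * (1 - crossConcurrence ρ.mat) =
      crossConcurrence ρ.mat ^ 2) :
    (ρ.mat (0, 1) (0, 1)).re * (ρ.mat (1, 0) (1, 0)).re = 0 ∧
    (ρ.mat (0, 1) (0, 1)).re + (ρ.mat (1, 0) (1, 0)).re = 1 - crossConcurrence ρ.mat ∧
    2 * ‖ρ.mat (0, 0) (1, 1)‖ = crossConcurrence ρ.mat ∧
    2 * (ρ.mat (0, 0) (0, 0)).re = crossConcurrence ρ.mat ∧
    2 * (ρ.mat (1, 1) (1, 1)).re = crossConcurrence ρ.mat := by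
  have hbound := sq_crossConcurrence_add_le ρ
  have hnorm := four_mul_sq_norm_le ρ
  have hX1 := crossConcurrence_le_one_sub ρ
  have hminor := sq_norm_le_mul_re ρ.posSemidef (0, 0) (1, 1)
  have htrace := re_diag_add_eq_one ρ
  have hdef : crossConcurrence ρ.mat = 2 * ‖ρ.mat (0, 0) (1, 1)‖ -
    2 * √((ρ.mat (0, 1) (0, 1)).re * (ρ.mat (1, 0) (1, 0)).re) := rfl
  have hab := mul_nonneg (re_diag_nonneg ρ.posSemidef (0, 1)) (re_diag_nonneg ρ.posSemidef (1, 0))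
  set X := crossConcurrence ρ.mat
  set N := negativity ρ
  set a := (ρ.mat (0, 1) (0, 1)).re
  set b := (ρ.mat (1, 0) (1, 0)).re
  set p := (ρ.mat (0, 0) (0, 0)).re
  set s := (ρ.mat (1, 1) (1, 1)).re
  have hN : 0 < N := (negativity_nonneg ρ).lt_of_ne fun h => by
    simp only [N, ← h] at heq
    nlinarith
  have hsqrt : √(a * b) = 0 := by nlinarith [Real.sqrt_nonneg (a * b)]
  have hab0 : a * b = 0 := (Real.sqrt_eq_zero hab).1 hsqrt
  rw [hsqrt, mul_zero, sub_zero] at hdef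
  rw [hsqrt] at hX1
  have hsum : a + b = 1 - X := by
    refine le_antisymm (by linarith) (le_of_mul_le_mul_left ?_ hN)
    rw [show ‖ρ.mat (0, 0) (1, 1)‖ = X / 2 by linarith] at hnorm
    linarith
  have hps : p = s := by
    rw [show ‖ρ.mat (0, 0) (1, 1)‖ = (p + s) / 2 by linarith] at hminor
    nlinarith [sq_nonneg (p - s)]
  exact ⟨hab0, hsum, hdef.symm, by linarith, by linarith⟩

theorem apply_eq_zero_of_antiVec_eigenvector {B : Matrix Idx Idx ℂ}
    (hzero : ∀ i, B (1, 0) i = 0 ∧ B i (1, 0) = 0) {x y μ : ℂ} (hx : x ≠ 0)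
    (h : partialTranspose B *ᵥ antiVec x y = μ • antiVec x y) :
    B (0, 1) (0, 0) = 0 ∧ B (1, 1) (0, 1) = 0 := by
  have h00 := congrFun h (0, 0)
  have h11 := congrFun h (1, 1)
  simp only [mulVec, dotProduct, Fintype.sum_prod_type, Fin.sum_univ_two, partialTranspose,
    antiVec, ofCoeff, of_apply, cons_val', cons_val_zero, cons_val_one, cons_val_fin_one,
    Pi.smul_apply, smul_zero, hzero, mul_zero, zero_mul, zero_add, add_zero] at h00 h11
  exact ⟨(mul_eq_zero.1 h00).resolve_right hx, (mul_eq_zero.1 h11).resolve_right hx⟩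

theorem eq_localConj_quasiDistillable {B : Matrix Idx Idx ℂ} (hB : B.IsHermitian) {c : ℝ} {η : ℂ}
    (hη : star η * η = 1) (hzero : ∀ i, B (1, 0) i = 0 ∧ B i (1, 0) = 0)
    (h10 : B (0, 1) (0, 0) = 0) (h21 : B (1, 1) (0, 1) = 0) (h20 : B (0, 0) (1, 1) = c / 2 * η)
    (h00 : B (0, 0) (0, 0) = c / 2) (h11 : B (0, 1) (0, 1) = 1 - c)
    (h22 : B (1, 1) (1, 1) = c / 2) :
    B = localConj (diagonal ![1, star η]) 1 (quasiDistillable c) := by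
  have h01 : B (0, 0) (0, 1) = 0 := by rw [← hB.apply, h10, star_zero]
  have h12 : B (0, 1) (1, 1) = 0 := by rw [← hB.apply, h21, star_zero]
  have h02 : B (1, 1) (0, 0) = (c / 2 : ℂ) * star η := by
    rw [← hB.apply, h20]
    simp [mul_comm]
  have hdiag : diagonal ![1, star η] ⊗ₖ (1 : Matrix (Fin 2) (Fin 2) ℂ) =
      diagonal fun a : Idx => (![1, star η] : Fin 2 → ℂ) a.1 := by
    rw [← diagonal_one, diagonal_kronecker_diagonal]
    simp
  rw [localConj, hdiag, diagonal_conjTranspose]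
  ext ⟨i, j⟩ ⟨k, l⟩
  rw [mul_diagonal, diagonal_mul, quasiDistillable_apply]
  fin_cases i <;> fin_cases j <;> fin_cases k <;> fin_cases l <;>
    simp [ket, h10, h01, h21, h12, h00, h11, h22, h02, h20, hzero]
  · ring
  · rw [← RCLike.star_def]
    linear_combination (-(c / 2 : ℂ)) * hη

theorem localUnitaryEquiv_quasiDistillable_of_re_eq_zero (ρ : State)
    (hX : 0 < crossConcurrence ρ.mat)
    (heq : negativity ρ ^ 2 + 2 * negativity ρ * (1 - crossConcurrence ρ.mat) =
      crossConcurrence ρ.mat ^ 2) (hb : (ρ.mat (1, 0) (1, 0)).re = 0) :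
    LocalUnitaryEquiv ρ.mat (quasiDistillable (crossConcurrence ρ.mat)) := by
  have hH := ρ.posSemidef.isHermitian
  obtain ⟨-, ha, hr, hp, hs⟩ := re_eq_of_sq_crossConcurrence_eq ρ hX heq
  rw [hb, add_zero] at ha
  obtain ⟨ω, hω, hform⟩ := exists_phase_ptForm_antiVec hH
  have hzero := apply_eq_zero_of_re_eq_zero ρ.posSemidef hb
  set X := crossConcurrence ρ.mat
  set y := negativity ρ + 2 * (1 - X) with hy
  have heig := partialTranspose_mulVec_of_ptForm_eq ρ (v := antiVec X (y * ω)) <| by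
    rw [hform, vecNormSq_antiVec, norm_mul, hω, Complex.norm_real, Complex.norm_real,
      Real.norm_eq_abs, Real.norm_eq_abs, mul_one, sq_abs, sq_abs, hb, ha, hy]
    linear_combination (y / 2) * heq - X * y * hr
  have hX0 : (X : ℂ) ≠ 0 := Complex.ofReal_ne_zero.2 hX.ne'
  obtain ⟨h10, h21⟩ := apply_eq_zero_of_antiVec_eigenvector hzero hX0 heig
  have hdiag (i : Idx) {t : ℝ} (ht : (ρ.mat i i).re = t) : ρ.mat i i = t :=
    (hH.coe_re_apply_self i).symm.trans (congrArg _ ht)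
  set η := ρ.mat (0, 0) (1, 1) / (X / 2)
  have hη : star η * η = 1 := by
    have hnorm : ‖η‖ = 1 := by
      rw [norm_div, norm_div, Complex.norm_real, Real.norm_of_nonneg hX.le, Complex.norm_two,
        div_eq_one_iff_eq (half_pos hX).ne', ← hr, mul_div_cancel_left₀ _ two_ne_zero]
    rw [RCLike.star_def, Complex.conj_mul', hnorm, Complex.ofReal_one, one_pow]
  have hB := eq_localConj_quasiDistillable (c := X) hH hη hzero h10 h21
    (by simp only [η]; field_simp) (by simpa using hdiag _ (t := X / 2) (by linarith))
    (by simpa using hdiag _ ha) (by simpa using hdiag _ (t := X / 2) (by linarith))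
  have hD : diagonal ![1, star η] ∈ unitaryGroup (Fin 2) ℂ := by
    rw [mem_unitaryGroup_iff, star_eq_conjTranspose, diagonal_conjTranspose,
      diagonal_mul_diagonal, ← diagonal_one]
    congr 1
    ext i
    fin_cases i
    · simp
    · simpa using hη
  exact ⟨_, hD, 1, one_mem _, hB⟩

theorem localUnitaryEquiv_submatrix_swap (A : Matrix Idx Idx ℂ) :
    LocalUnitaryEquiv (A.submatrix (Prod.map (Equiv.swap 0 1) (Equiv.swap 0 1))
      (Prod.map (Equiv.swap 0 1) (Equiv.swap 0 1))) A := by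
  let e : Equiv.Perm (Fin 2) := Equiv.swap 0 1
  have hP : (1 : Matrix (Fin 2) (Fin 2) ℂ).submatrix id e ∈ unitaryGroup (Fin 2) ℂ :=
    submatrix_equiv_mem_unitaryGroup (one_mem _) e
  have hkron : (1 : Matrix (Fin 2) (Fin 2) ℂ).submatrix id e ⊗ₖ
      (1 : Matrix (Fin 2) (Fin 2) ℂ).submatrix id e =
        (1 : Matrix Idx Idx ℂ).submatrix id (e.prodCongr e) := by
    rw [← one_kronecker_one]
    rfl
  refine ⟨_, hP, _, hP, ?_⟩
  rw [hkron, conjTranspose_submatrix, conjTranspose_one, one_submatrix_mul, mul_submatrix_one]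
  rfl

theorem localUnitaryEquiv_quasiDistillable_of_negativity_eq (ρ : State) (hC : 0 < concurrence ρ)
    (heq : negativity ρ ^ 2 + 2 * negativity ρ * (1 - concurrence ρ) = concurrence ρ ^ 2) :
    LocalUnitaryEquiv ρ.mat (quasiDistillable (concurrence ρ)) := by
  obtain ⟨σ, hρσ, hσ⟩ := exists_localUnitaryEquiv_crossConcurrence_eq ρ hC
  rw [hσ] at hC heq ⊢
  rw [hρσ.negativity_eq] at heq
  refine hρσ.trans ?_
  rcases mul_eq_zero.1 (re_eq_of_sq_crossConcurrence_eq σ hC heq).1 with ha | hb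
  · let τ : State := ⟨_, σ.posSemidef.submatrix (Prod.map (Equiv.swap 0 1) (Equiv.swap 0 1)),
      (Equiv.sum_comp ((Equiv.swap 0 1).prodCongr (Equiv.swap 0 1)) σ.mat.diag).trans
        σ.trace_eq_one⟩
    have hτσ : LocalUnitaryEquiv τ.mat σ.mat := localUnitaryEquiv_submatrix_swap σ.mat
    have hX : crossConcurrence τ.mat = crossConcurrence σ.mat := by
      simp only [τ, crossConcurrence, submatrix_apply, Prod.map_apply, Equiv.swap_apply_left,
        Equiv.swap_apply_right]
      rw [← σ.posSemidef.isHermitian.apply (0, 0), norm_star, mul_comm (σ.mat (1, 0) (1, 0)).re]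
    rw [← hτσ.negativity_eq, ← hX] at heq
    rw [← hX] at hC ⊢
    exact hτσ.symm.trans (localUnitaryEquiv_quasiDistillable_of_re_eq_zero τ hC heq ha)
  · exact localUnitaryEquiv_quasiDistillable_of_re_eq_zero σ hC heq hb

end LowerBoundEquality

section BellEigenvector

theorem isBellUpToLocalUnitary_of_half_le {v : Idx → ℂ} (hv : vecNormSq v = 1)
    (hdet : 1 / 2 ≤ ‖vecDet v‖) : IsBellUpToLocalUnitary v := by
  have hne : vecDet v ≠ 0 := norm_pos_iff.1 (by linarith)
  obtain ⟨U, hU, V, hV, d, hd, rfl⟩ := exists_schmidt hne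
  rw [vecNormSq_mulVec (kronecker_mem_unitary hU hV)] at hv
  rw [norm_vecDet_kronecker_mulVec hU hV] at hdet
  simp only [vecNormSq_eq, vecDet, ofCoeff, diagonal_apply, Fin.isValue, ↓reduceIte, zero_ne_one,
    one_ne_zero, norm_zero, norm_mul, Complex.norm_real, Real.norm_eq_abs, mul_zero,
    sub_zero, abs_of_pos (hd _)] at hv hdet
  have heq : d 0 = d 1 := by nlinarith [sq_nonneg (d 0 - d 1)]
  have hd1 : d 1 = (√2)⁻¹ := by
    rw [heq] at hv
    rw [← Real.sqrt_inv, eq_comm, Real.sqrt_eq_iff_mul_self_eq (by norm_num) (hd 1).le]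
    linarith
  refine ⟨U, hU, V, hV, 0, congrArg _ ?_⟩
  rw [← ofCoeff_coeffMatrix (bell 0), coeffMatrix_bell]
  congr 1
  ext i j
  fin_cases i <;> fin_cases j <;> simp [realPauli, heq, hd1]

theorem IsBellUpToLocalUnitary.norm_vecDet {v : Idx → ℂ} (hv : IsBellUpToLocalUnitary v) :
    ‖vecDet v‖ = 1 / 2 := by
  obtain ⟨U, hU, V, hV, k, rfl⟩ := hv
  rw [norm_vecDet_kronecker_mulVec hU hV, norm_vecDet_bell]

theorem IsBellUpToLocalUnitary.polarDet_eq_zero {v w : Idx → ℂ} (hv : IsBellUpToLocalUnitary v)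
    (hvw : star v ⬝ᵥ w = 0) : polarDet (coeffMatrix v) (coeffMatrix w) = 0 := by
  obtain ⟨U, hU, V, hV, k, rfl⟩ := hv
  set P := U ⊗ₖ V
  have hw : P *ᵥ Pᴴ *ᵥ w = w := by
    rw [mulVec_mulVec, ← star_eq_conjTranspose,
      mem_unitaryGroup_iff.1 (kronecker_mem_unitary hU hV), one_mulVec]
  rw [star_mulVec, ← dotProduct_mulVec, star_bell_dotProduct, mul_eq_zero_iff_left (by simp)] at hvw
  rw [← hw, coeffMatrix_kronecker_mulVec, coeffMatrix_kronecker_mulVec, polarDet_mul_mul,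
    coeffMatrix_bell, polarDet_smul_left]
  refine mul_eq_zero_of_right _ (mul_eq_zero_of_right _ ?_)
  fin_cases k <;> simp [polarDet, realPauli, coeffMatrix] at hvw ⊢ <;>
    grind

theorem IsBellUpToLocalUnitary.vecDet_smul_add {v w : Idx → ℂ} (hv : IsBellUpToLocalUnitary v)
    (hvw : star v ⬝ᵥ w = 0) (α : ℂ) : vecDet (α • v + w) = α ^ 2 * vecDet v + vecDet w := by
  have hpolar : polarDet (coeffMatrix (α • v)) (coeffMatrix w) =
      α * polarDet (coeffMatrix v) (coeffMatrix w) := polarDet_smul_left α _ _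
  rw [vecDet_add, hpolar, hv.polarDet_eq_zero hvw, vecDet_smul, mul_zero, add_zero]

theorem ptForm_smul_add_of_eigenvector {A : Matrix Idx Idx ℂ} (hA : A.IsHermitian) {μ : ℝ}
    {v w : Idx → ℂ} (hv : partialTranspose A *ᵥ v = (μ : ℂ) • v) (hv1 : vecNormSq v = 1)
    (hvw : star v ⬝ᵥ w = 0) (α : ℂ) :
    ptForm A (α • v + w) = ‖α‖ ^ 2 * μ + ptForm A w := by
  rw [ptForm_add_of_eigenvector hA (by rw [mulVec_smul, hv, smul_comm]) (by simp [hvw]),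
    ptForm_vec_smul, ptForm_of_eigenvector hv, hv1, mul_one]

-- `α • v + w` is a product vector for a suitable `α`, and `ptForm ρ.mat` is nonnegative there.
theorem neg_mul_norm_vecDet_le_ptForm (ρ : State) {μ : ℝ} {v w : Idx → ℂ}
    (hv1 : vecNormSq v = 1) (hv : partialTranspose ρ.mat *ᵥ v = (μ : ℂ) • v)
    (hbell : IsBellUpToLocalUnitary v) (hvw : star v ⬝ᵥ w = 0) :
    -(2 * μ) * ‖vecDet w‖ ≤ ptForm ρ.mat w := by
  have hdet := hbell.norm_vecDet
  have hne : vecDet v ≠ 0 := norm_pos_iff.1 (by linarith)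
  obtain ⟨α, hα⟩ := IsAlgClosed.exists_pow_nat_eq (-(vecDet w / vecDet v)) two_pos
  have hprod : vecDet (α • v + w) = 0 := by
    rw [hbell.vecDet_smul_add hvw, hα, neg_mul, div_mul_cancel₀ _ hne, neg_add_cancel]
  have hnorm : ‖α‖ ^ 2 = 2 * ‖vecDet w‖ := by
    rw [← norm_pow, hα, norm_neg, norm_div, hdet]
    ring
  have hform := neg_ptForm_le_concurrence ρ (α • v + w)
  rw [hprod, norm_zero, mul_zero,
    ptForm_smul_add_of_eigenvector ρ.posSemidef.isHermitian hv hv1 hvw, hnorm] at hform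
  linarith

theorem concurrence_le_of_isBellUpToLocalUnitary (ρ : State) {μ : ℝ} {v : Idx → ℂ} (hμ : μ ≤ 0)
    (hv1 : star v ⬝ᵥ v = 1) (hv : partialTranspose ρ.mat *ᵥ v = (μ : ℂ) • v)
    (hbell : IsBellUpToLocalUnitary v) : concurrence ρ ≤ -(2 * μ) := by
  have hnorm : vecNormSq v = 1 := by exact_mod_cast (star_dotProduct_self v).symm.trans hv1
  refine (concurrence_le_iff ρ (by linarith)).2 fun ψ => ?_
  set α := star v ⬝ᵥ ψ
  obtain ⟨w, hψ, hvw⟩ : ∃ w, ψ = α • v + w ∧ star v ⬝ᵥ w = 0 :=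
    ⟨ψ - α • v, by abel, by
      rw [dotProduct_sub, dotProduct_smul, hv1, smul_eq_mul, mul_one, sub_self]⟩
  have hform := neg_mul_norm_vecDet_le_ptForm ρ hnorm hv hbell hvw
  have hdet : ‖α‖ ^ 2 / 2 - ‖vecDet w‖ ≤ ‖vecDet ψ‖ := by
    have h := norm_sub_norm_le (α ^ 2 * vecDet v) (-vecDet w)
    rw [norm_neg, sub_neg_eq_add, norm_mul, norm_pow, hbell.norm_vecDet,
      ← hbell.vecDet_smul_add hvw, ← hψ] at h
    linarith
  calc -ptForm ρ.mat ψ = -(‖α‖ ^ 2 * μ + ptForm ρ.mat w) := by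
        rw [hψ, ptForm_smul_add_of_eigenvector ρ.posSemidef.isHermitian hv hnorm hvw]
    _ ≤ -(2 * μ) * (‖α‖ ^ 2 / 2 - ‖vecDet w‖) := by linarith
    _ ≤ -(2 * μ) * ‖vecDet ψ‖ := mul_le_mul_of_nonneg_left hdet (by linarith)

theorem negativity_eq_concurrence_iff (ρ : State) {μ : ℝ} {v : Idx → ℂ}
    (hC : 0 < concurrence ρ) (hμ : μ ≤ 0) (hv1 : star v ⬝ᵥ v = 1)
    (hv : partialTranspose ρ.mat *ᵥ v = (μ : ℂ) • v) (hN : negativity ρ = 2 * |μ|) :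
    negativity ρ = concurrence ρ ↔ IsBellUpToLocalUnitary v := by
  rw [abs_of_nonpos hμ, mul_neg] at hN
  refine ⟨fun h => ?_, fun h => (negativity_le_concurrence ρ).antisymm
    (hN ▸ concurrence_le_of_isBellUpToLocalUnitary ρ hμ hv1 hv h)⟩
  have hnorm : vecNormSq v = 1 := by exact_mod_cast (star_dotProduct_self v).symm.trans hv1
  have hform := neg_ptForm_le_concurrence ρ v
  rw [ptForm_of_eigenvector hv, hnorm] at hform
  exact isBellUpToLocalUnitary_of_half_le hnorm (le_of_mul_le_mul_left (by linarith) hC)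

end BellEigenvector

section Pure

theorem ptForm_proj {z v : Idx → ℂ} {M : Matrix (Fin 2) (Fin 2) ℂ}
    (hM : (coeffMatrix v)ᴴ * coeffMatrix z = M) :
    ptForm (proj z) v = ‖M 0 0‖ ^ 2 + ‖M 1 1‖ ^ 2 + 2 * (M 0 1 * star (M 1 0)).re := by
  have htrace : ptForm (proj z) v = (M * M.map star).trace.re := by
    rw [← hM, ptForm]
    congr 1
    simp [partialTranspose, proj, coeffMatrix, mulVec, dotProduct, Fintype.sum_prod_type,
      Matrix.mul_apply, Fin.sum_univ_two, vecMulVec_apply, trace_fin_two]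
    ring
  rw [htrace]
  simp only [trace_fin_two, Matrix.mul_apply, Fin.sum_univ_two, map_apply, Complex.add_re,
    Complex.mul_re, RCLike.star_def, Complex.conj_re, Complex.conj_im, Complex.sq_norm,
    Complex.normSq_apply]
  ring

theorem neg_ptForm_proj_le (z v : Idx → ℂ) :
    -ptForm (proj z) v ≤ 2 * ‖vecDet z‖ * ‖vecDet v‖ := by
  set M := (coeffMatrix v)ᴴ * coeffMatrix z with hM
  have hdet : ‖M.det‖ = ‖vecDet z‖ * ‖vecDet v‖ := by
    rw [det_mul, det_conjTranspose, det_coeffMatrix, det_coeffMatrix, norm_mul, norm_star, mul_comm]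
  have hoff : ‖M 0 1 * M 1 0‖ - ‖M 0 0‖ * ‖M 1 1‖ ≤ ‖M.det‖ := by
    rw [det_fin_two, norm_sub_rev, ← norm_mul]
    exact norm_sub_norm_le _ _
  have hre : -(M 0 1 * star (M 1 0)).re ≤ ‖M 0 1 * M 1 0‖ := by
    refine (neg_le_abs _).trans ((Complex.abs_re_le_norm _).trans_eq ?_)
    rw [norm_mul, norm_star, ← norm_mul]
  rw [ptForm_proj hM.symm]
  linarith [two_mul_le_add_sq ‖M 0 0‖ ‖M 1 1‖]

theorem exists_neg_ptForm_proj_eq {z : Idx → ℂ} (hz : vecDet z ≠ 0) :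
    ∃ v, vecNormSq v = 2 ∧ -ptForm (proj z) v = 2 * ‖vecDet z‖ := by
  obtain ⟨U, hU, V, hV, d, hd, rfl⟩ := exists_schmidt hz
  set z' := ofCoeff (diagonal fun i => (d i : ℂ)) with hz'
  obtain ⟨v, hform, hnorm, -⟩ :=
    (localUnitaryEquiv_localConj hU hV (proj z')).symm.exists_ptForm_eq (antiVec 1 (-1))
  refine ⟨v, ?_, ?_⟩
  · rw [hnorm, vecNormSq_antiVec]
    norm_num
  · have hM : (coeffMatrix (antiVec 1 (-1)))ᴴ * coeffMatrix z' =
        !![0, -(d 1 : ℂ); (d 0 : ℂ), 0] := by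
      ext i j
      fin_cases i <;> fin_cases j <;> simp [antiVec, hz', Matrix.mul_apply, Fin.sum_univ_two]
    rw [localConj_proj] at hform
    rw [← hform, ptForm_proj hM, norm_vecDet_kronecker_mulVec hU hV]
    simp [hz', vecDet, ofCoeff, abs_of_pos (hd _)]
    ring

theorem negativity_eq_concurrence_of_isPure (ρ : State) (h : ρ.IsPure) :
    negativity ρ = concurrence ρ := by
  obtain ⟨z, hz⟩ := h
  refine (negativity_le_concurrence ρ).antisymm ?_
  calc concurrence ρ ≤ 2 * ‖vecDet z‖ :=
        (concurrence_le_iff ρ (by positivity)).2 fun v => hz ▸ neg_ptForm_proj_le z v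
    _ ≤ negativity ρ := ?_
  by_cases h0 : vecDet z = 0
  · rw [h0, norm_zero, mul_zero]
    exact negativity_nonneg ρ
  · obtain ⟨v, hnorm, hform⟩ := exists_neg_ptForm_proj_eq h0
    rw [← hform, ← hz]
    refine (neg_ptForm_le_negativity ρ v).trans_eq ?_
    rw [hnorm, div_mul_cancel₀ _ two_ne_zero]

end Pure

section BellDiagonal

theorem star_bell_dotProduct_bellDiagonal_mulVec (p : Fin 4 → ℝ) (k : Fin 4) :
    star (bell k) ⬝ᵥ bellDiagonal p *ᵥ bell k = p k := by
  simp [bellDiagonal, sum_mulVec, smul_mulVec, proj, vecMulVec_mulVec,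
    star_bell_dotProduct_bell]

theorem nonneg_of_posSemidef_bellDiagonal {p : Fin 4 → ℝ} (h : (bellDiagonal p).PosSemidef)
    (k : Fin 4) : 0 ≤ p k := by
  have hk := h.dotProduct_mulVec_nonneg (bell k)
  rw [star_bell_dotProduct_bellDiagonal_mulVec] at hk
  exact_mod_cast hk

theorem negativity_eq_concurrence_of_isBellDiagonal (ρ : State) (h : ρ.IsBellDiagonal) :
    negativity ρ = concurrence ρ := by
  obtain ⟨p, hp⟩ := h
  change ρ.mat = bellDiagonal p at hp
  have hp0 := nonneg_of_posSemidef_bellDiagonal (hp ▸ ρ.posSemidef)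
  obtain ⟨m, hm⟩ := Finite.exists_max p
  have hN : 2 * p m - ∑ k, p k ≤ negativity ρ := by
    have h := neg_ptForm_le_negativity ρ (bell m.rev)
    rw [hp, ptForm_bellDiagonal_bell, vecNormSq_bell] at h
    linarith
  refine (negativity_le_concurrence ρ).antisymm ?_
  calc concurrence ρ ≤ max 0 (2 * p m - ∑ k, p k) :=
        (concurrence_le_iff ρ (le_max_left _ _)).2 fun v =>
          hp ▸ neg_ptForm_bellDiagonal_le hp0 hm v
    _ ≤ negativity ρ := max_le (negativity_nonneg ρ) hN

end BellDiagonal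

end TwoQubit

theorem theorem2 (ρ : TwoQubit.State) :
    -- upper bound
    TwoQubit.negativity ρ ≤ TwoQubit.concurrence ρ ∧
    -- for entangled states: the negative eigenvalue `μ` of the partial transpose, its eigenvector
    -- `v` (unique up to a scalar), and the equality case of the upper bound
    (0 < TwoQubit.concurrence ρ →
      ∃ (μ : ℝ) (v : TwoQubit.Idx → ℂ), μ < 0 ∧ star v ⬝ᵥ v = 1 ∧
        TwoQubit.partialTranspose ρ.mat *ᵥ v = (μ : ℂ) • v ∧
        (∀ (ν : ℝ) (w : TwoQubit.Idx → ℂ), ν < 0 → w ≠ 0 →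
          TwoQubit.partialTranspose ρ.mat *ᵥ w = (ν : ℂ) • w → ν = μ ∧ ∃ c : ℂ, w = c • v) ∧
        TwoQubit.negativity ρ = 2 * |μ| ∧
        (TwoQubit.negativity ρ = TwoQubit.concurrence ρ ↔ TwoQubit.IsBellUpToLocalUnitary v)) ∧
    -- pure states and Bell-diagonal states attain the upper bound
    (ρ.IsPure → TwoQubit.negativity ρ = TwoQubit.concurrence ρ) ∧
    (ρ.IsBellDiagonal → TwoQubit.negativity ρ = TwoQubit.concurrence ρ) ∧
    -- lower bound, in both forms
    √((1 - TwoQubit.concurrence ρ) ^ 2 + TwoQubit.concurrence ρ ^ 2) -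
        (1 - TwoQubit.concurrence ρ) ≤ TwoQubit.negativity ρ ∧
    0 ≤ TwoQubit.negativity ρ ^ 2 +
        2 * TwoQubit.negativity ρ * (1 - TwoQubit.concurrence ρ) - TwoQubit.concurrence ρ ^ 2 ∧
    -- equality case of the lower bound, for entangled states
    (0 < TwoQubit.concurrence ρ →
      (TwoQubit.negativity ρ =
          √((1 - TwoQubit.concurrence ρ) ^ 2 + TwoQubit.concurrence ρ ^ 2) -
            (1 - TwoQubit.concurrence ρ) ↔
        TwoQubit.LocalUnitaryEquiv ρ.mat
          (TwoQubit.quasiDistillable (TwoQubit.concurrence ρ))) ∧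
      (TwoQubit.concurrence ρ < 1 →
        (TwoQubit.quasiDistillable (TwoQubit.concurrence ρ)).rank = 2)) ∧
    -- the weight of the Bell state in a quasi-distillable state is its concurrence
    (∀ c : ℝ, 0 ≤ c → c ≤ 1 →
      TwoQubit.LocalUnitaryEquiv ρ.mat (TwoQubit.quasiDistillable c) →
        TwoQubit.concurrence ρ = c) := by
  refine ⟨TwoQubit.negativity_le_concurrence ρ, fun hC => ?_,
    TwoQubit.negativity_eq_concurrence_of_isPure ρ,
    TwoQubit.negativity_eq_concurrence_of_isBellDiagonal ρ, TwoQubit.sqrt_sub_le_negativity ρ, ?_,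
    fun hC => ⟨⟨fun h => ?_, TwoQubit.negativity_of_quasiDistillable ρ hC⟩,
      TwoQubit.rank_quasiDistillable hC⟩,
    fun c h0 h1 => TwoQubit.concurrence_of_quasiDistillable ρ h0 h1⟩
  · obtain ⟨μ, v, hμ, hv1, hv, hN⟩ :=
      TwoQubit.exists_negative_eigenvector ρ (TwoQubit.negativity_pos ρ hC)
    exact ⟨μ, v, hμ, hv1, hv,
      fun ν w hν hw0 hw =>
        TwoQubit.negative_eigenvector_unique ρ.posSemidef hμ hν hv1 hw0 hv hw, hN,
      TwoQubit.negativity_eq_concurrence_iff ρ hC hμ.le hv1 hv hN⟩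
  · linarith [TwoQubit.sq_concurrence_le ρ]
  · exact TwoQubit.localUnitaryEquiv_quasiDistillable_of_negativity_eq ρ hC
      (TwoQubit.sq_add_two_mul_mul_eq_sq h)
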